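/- Theorem 4.4. There is a universal constant $C > 0$ such that the following holds for all integers $M \geq N$, $T \geq 0$ and $K$ with $1 \leq K \leq N/8$. Consider any $T$-query quantum algorithm with oracle access to a function $f : [M] \to [N]$: its memory has the orthonormal basis $|x,p,w\rangle$ with $x \in [M]$, $p \in [N]$ and $w$ in a finite set, and it is given by unitaries $U_0,\dots,U_T$ on this memory, independent of $f$. Its final state is $U_T \mathcal{O}_f U_{T-1} \cdots U_1 \mathcal{O}_f U_0 |0\rangle$, where $|0\rangle$ is a fixed basis state and $\mathcal{O}_f |x,p,w\rangle = e^{2\pi \mathbf{i}\, p f(x)/N} |x,p,w\rangle$. The value $w$ is then measured, and a list of $K$ pairs $(x_1,x_2),\dots,(x_{2K-1},x_{2K}) \in [M]^2$ is read off it. The algorithm succeeds on $f$ if $x_1,\dots,x_{2K}$ are all different and $f(x_{2i-1}) = f(x_{2i})$ for every $1 \leq i \leq K$. Then, for $f$ uniformly random among all functions $[M] \to [N]$, the success probability (over $f$ and the measurement) is at most \[ \left( \frac{C\, T^3}{K^2 N} \right)^{K/2} + 2^{-K} . \] In particular, $C$ depends neither on $M$ nor on any other parameter. -/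

import Mathlib

noncomputable section

/-- Labels `(x, p, w)` of the computational basis states `|x, p, w⟩`: the query register holds
`x ∈ [M]`, the phase register holds `p ∈ [N]` and the working register holds `w ∈ W`. -/
abbrev BasisLabel (M N : ℕ) (W : Type) : Type := Fin M × Fin N × W

/-- The Hilbert space of the algorithm's memory, with orthonormal basis `|x, p, w⟩`. -/
abbrev Memory (M N : ℕ) (W : Type) : Type := EuclideanSpace ℂ (BasisLabel M N W)

/-- The primitive root of unity `ω_N = exp (2 π i / N)`. -/
def omega (N : ℕ) : ℂ := Complex.exp (2 * Real.pi * Complex.I / N)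

/-- The phase oracle `|x, p, w⟩ ↦ ω_N ^ (p f(x)) |x, p, w⟩` of the input function `f`. -/
def oracle {M N : ℕ} {W : Type} [Fintype W] (f : Fin M → Fin N) :
    Memory M N W →ₗ[ℂ] Memory M N W where
  toFun ψ := WithLp.toLp 2 fun b => omega N ^ ((b.2.1 : ℕ) * (f b.1 : ℕ)) * ψ b
  map_add' ψ φ := by ext b; simp [mul_add]
  map_smul' c ψ := by ext b; simp [mul_left_comm]

/-- The projector onto the span of the basis states with label in `S`. -/
def basisProj {M N : ℕ} {W : Type} [Fintype W] (S : Set (BasisLabel M N W)) :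
    Memory M N W →ₗ[ℂ] Memory M N W where
  toFun ψ := WithLp.toLp 2 (S.indicator fun b => ψ b)
  map_add' ψ φ := by ext b; by_cases h : b ∈ S <;> simp [h]
  map_smul' c ψ := by ext b; by_cases h : b ∈ S <;> simp [h]

/-- A quantum algorithm making `T` queries to an input `f : [M] → [N]`, with working register
holding values in the finite set `W` and with outputs in `Z`.
The unitaries `U 0, …, U T` act on the whole memory and do not depend on `f`. -/
structure QueryAlgorithm (M N T : ℕ) (W Z : Type) [Fintype W] where
  /-- the label of the initial basis state `|0⟩` -/
  start : BasisLabel M N W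
  /-- the unitary transformations `U_0, …, U_T` -/
  U : Fin (T + 1) → (Memory M N W ≃ₗᵢ[ℂ] Memory M N W)
  /-- the output `z` that is read off the value `w` of the working register -/
  output : W → Z

namespace QueryAlgorithm

variable {M N T : ℕ} {W Z : Type} [Fintype W] [DecidableEq W]

/-- The state `U_t O_f U_{t-1} ⋯ U_1 O_f U_0 |0⟩` after `t ≤ T` queries to `f`. -/
def state (A : QueryAlgorithm M N T W Z) (f : Fin M → Fin N) (t : Fin (T + 1)) :
    Memory M N W :=
  Fin.induction (motive := fun _ => Memory M N W)
    (A.U 0 (EuclideanSpace.single A.start 1))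
    (fun s ψ => A.U s.succ (oracle f ψ)) t

/-- The probability that measuring the working register of the final state on input `f` gives an
output `z` with `R f z`. -/
def successProbOn (A : QueryAlgorithm M N T W Z) (R : (Fin M → Fin N) → Z → Prop)
    (f : Fin M → Fin N) : ℝ :=
  ‖basisProj {b | R f (A.output b.2.2)} (A.state f (Fin.last T))‖ ^ 2

/-- The success probability on a uniformly random function `f : [M] → [N]`. -/
def successProb (A : QueryAlgorithm M N T W Z) (R : (Fin M → Fin N) → Z → Prop) : ℝ :=
  (∑ f : Fin M → Fin N, A.successProbOn R f) / (N : ℝ) ^ M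

end QueryAlgorithm

/-- `(x₁, x₂)` is a collision pair of `f`. -/
def IsCollision {M N : ℕ} (f : Fin M → Fin N) (c : Fin M × Fin M) : Prop :=
  c.1 ≠ c.2 ∧ f c.1 = f c.2

/-- No entry of the pair `c` is an entry of the pair `d`. -/
def DisjointPairs {M : ℕ} (c d : Fin M × Fin M) : Prop :=
  c.1 ≠ d.1 ∧ c.1 ≠ d.2 ∧ c.2 ≠ d.1 ∧ c.2 ≠ d.2

/-- The list `z` consists of `K` mutually disjoint collision pairs of `f`. -/
def AreDisjointCollisions {M N K : ℕ} (f : Fin M → Fin N) (z : Fin K → Fin M × Fin M) : Prop :=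
  (∀ i, IsCollision f (z i)) ∧ ∀ i j, i ≠ j → DisjointPairs (z i) (z j)

end

/-! The proof is a recording-query (compressed oracle) argument. A database register for each input
starts in `none`, written `⊥`. The Householder reflection `1 - v vᵀ` with `v = bottomSubUniform N`
exchanges `⊥` with the uniform superposition. Conjugating each phase query by this reflection of the
queried register gives `recordQuery`. Reflecting all registers at the end recovers, on total
databases, the states for all `f` with amplitude `N^(-M/2)` (`reflectOn_recordedState`).

Progress is measured by the excess: a value recorded at `m ≥ 1` inputs contributes `m - 1`. A query
to a database with at most `t` entries raises the excess only by hitting one of at most `t` recorded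
values, and each has squared overlap `1/N` with `v`. So the new amplitude at level `k + 1` is at
most `√(8t/N)` times the amplitude at levels `≥ k`. By induction the amplitude at levels `≥ k` is at
most `T.choose k * √(8T/N)^k` (`excessNorm_recordedState_le`). For `k = ⌈K/2⌉` its square is at most
`(288 T³/(K² N))^k`.

If the excess is below `⌈K/2⌉`, more than half of the `K` output pairs are not recorded collisions
and have to be guessed, at a price of order `1/N` each (`sum_norm_sq_reflectOn_collide_le`). For
large `N` this gives at most `4^(-K)`. Adding the two contributions proves the bound
(`successProb_le_excessNorm`). -/

noncomputable section

/-! ### Householder reflections on tensor factors. -/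

section Reflections

variable {ι α : Type*} [DecidableEq ι] [Fintype α]

/-- Summing over all functions and all values at `j` counts every function `card α` times. -/
theorem sum_sum_update [Fintype ι] (F : (ι → α) → ℝ) (j : ι) :
    ∑ D, ∑ y, F (Function.update D j y) = Fintype.card α * ∑ D, F D := by
  have h : ∑ q : (ι → α) × α, F (Function.update q.1 j q.2) = ∑ q : (ι → α) × α, F q.1 := by
    -- Exchanging the value at `j` with the extra value `y` is an involution of the pairs `(D, y)`.
    refine Fintype.sum_bijective (fun q => (Function.update q.1 j q.2, q.1 j)) ?_ _ _ fun _ => rfl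
    refine Function.Involutive.bijective fun q => ?_
    simp
  rw [Fintype.sum_prod_type, Fintype.sum_prod_type] at h
  simpa [Finset.mul_sum] using h

/-- An inequality between sums over functions may be checked on every fiber of the restriction
to the complement of `j`. -/
theorem sum_le_sum_of_update [Fintype ι] [Nonempty α] {F G : (ι → α) → ℝ} (j : ι)
    (h : ∀ D, ∑ y, F (Function.update D j y) ≤ ∑ y, G (Function.update D j y)) :
    ∑ D, F D ≤ ∑ D, G D := by
  have h1 := Finset.sum_le_sum fun D (_ : D ∈ Finset.univ) => h D
  rw [sum_sum_update, sum_sum_update] at h1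
  exact le_of_mul_le_mul_left h1 (by exact_mod_cast Fintype.card_pos)

theorem sum_le_sum_of_update₂ [Fintype ι] [Nonempty α] {F G : (ι → α) → ℝ} (i j : ι)
    (h : ∀ D, ∑ y, ∑ z, F (Function.update (Function.update D i y) j z)
      ≤ ∑ y, ∑ z, G (Function.update (Function.update D i y) j z)) :
    ∑ D, F D ≤ ∑ D, G D := by
  have h1 : ∑ D, ∑ z, F (Function.update D j z) ≤ ∑ D, ∑ z, G (Function.update D j z) :=
    sum_le_sum_of_update i h
  rw [sum_sum_update, sum_sum_update] at h1
  exact le_of_mul_le_mul_left h1 (by exact_mod_cast Fintype.card_pos)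

theorem norm_sum_mul_sq_le (v : α → ℝ) (s : α → ℂ) :
    ‖∑ y, (v y : ℂ) * s y‖ ^ 2 ≤ (∑ y, v y ^ 2) * ∑ y, ‖s y‖ ^ 2 := by
  calc ‖∑ y, (v y : ℂ) * s y‖ ^ 2 ≤ (∑ y, |v y| * ‖s y‖) ^ 2 := by
        gcongr
        refine (norm_sum_le _ _).trans (le_of_eq ?_)
        simp
    _ ≤ (∑ y, |v y| ^ 2) * ∑ y, ‖s y‖ ^ 2 := Finset.sum_mul_sq_le_sq_mul_sq _ _ _
    _ = _ := by simp

/-- The operator `1 - v vᵀ` on `ℂ^α`, a Householder reflection if `‖v‖² = 2`. -/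
def reflect (v : α → ℝ) (s : α → ℂ) (y : α) : ℂ := s y - v y * ∑ z, v z * s z

theorem reflect_add (v : α → ℝ) (s r : α → ℂ) (y : α) :
    reflect v (fun y => s y + r y) y = reflect v s y + reflect v r y := by
  simp only [reflect, mul_add, Finset.sum_add_distrib]
  ring

theorem sum_norm_sq_reflect {v : α → ℝ} (hv : ∑ y, v y ^ 2 = 2) (s : α → ℂ) :
    ∑ y, ‖reflect v s y‖ ^ 2 = ∑ y, ‖s y‖ ^ 2 := by
  simp only [reflect]
  set a := ∑ z, (v z : ℂ) * s z with ha
  have h1 : ∀ y, ‖s y - v y * a‖ ^ 2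
      = ‖s y‖ ^ 2 - 2 * (a.re * (v y * s y : ℂ).re + a.im * (v y * s y : ℂ).im)
        + v y ^ 2 * ‖a‖ ^ 2 := by
    intro y
    simp only [← Complex.normSq_eq_norm_sq, Complex.normSq_apply]
    simp
    ring
  simp only [h1, Finset.sum_add_distrib, Finset.sum_sub_distrib, ← Finset.mul_sum,
    ← Finset.sum_mul, hv, ← Complex.re_sum, ← Complex.im_sum]
  rw [← ha, ← Complex.normSq_eq_norm_sq, Complex.normSq_apply]
  ring

/-- The operator `1 - v vᵀ` applied to the tensor factor `j` of `(ℂ^α)^{⊗ ι}`. -/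
def reflectAt (v : α → ℝ) (j : ι) : Module.End ℂ ((ι → α) → ℂ) where
  toFun s D := s D - v (D j) * ∑ y, v y * s (Function.update D j y)
  map_add' s r := by
    ext D
    simp only [Pi.add_apply, mul_add, Finset.sum_add_distrib]
    ring
  map_smul' c s := by
    ext D
    simp only [Pi.smul_apply, smul_eq_mul, RingHom.id_apply, Finset.mul_sum, mul_sub]
    congr 1
    exact Finset.sum_congr rfl fun y _ => by ring

theorem reflectAt_apply (v : α → ℝ) (j : ι) (s : (ι → α) → ℂ) (D : ι → α) :
    reflectAt v j s D = s D - v (D j) * ∑ y, v y * s (Function.update D j y) := rfl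

theorem reflectAt_update (v : α → ℝ) (j : ι) (s : (ι → α) → ℂ) (D : ι → α) (y : α) :
    reflectAt v j s (Function.update D j y)
      = reflect v (fun z => s (Function.update D j z)) y := by
  simp [reflectAt_apply, reflect]

theorem reflectAt_commute (v : α → ℝ) (i j : ι) :
    Commute (reflectAt v i) (reflectAt v j) := by
  rcases eq_or_ne i j with rfl | hij
  · exact Commute.refl _
  refine LinearMap.ext fun s => funext fun D => ?_
  simp only [Module.End.mul_apply, reflectAt_apply, Function.update_of_ne hij,
    Function.update_of_ne hij.symm, mul_sub, Finset.sum_sub_distrib, Finset.mul_sum]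
  have : ∑ x, ∑ y, (v (D i) : ℂ) * (v x * (v (D j) * (v y *
      s (Function.update (Function.update D i x) j y))))
      = ∑ x, ∑ y, (v (D j) : ℂ) * (v x * (v (D i) * (v y *
      s (Function.update (Function.update D j x) i y)))) := by
    rw [Finset.sum_comm]
    refine Finset.sum_congr rfl fun x _ => Finset.sum_congr rfl fun y _ => ?_
    rw [Function.update_comm hij]
    ring
  rw [this]
  ring

theorem reflectAt_reflectAt {v : α → ℝ} (hv : ∑ y, v y ^ 2 = 2) (j : ι) (s : (ι → α) → ℂ) :
    reflectAt v j (reflectAt v j s) = s := by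
  ext D
  have hv' : ∑ y, (v y : ℂ) * (v y : ℂ) = 2 := by
    have := congrArg (fun r : ℝ => (r : ℂ)) hv
    simpa [sq] using this
  rw [reflectAt_apply]
  simp only [reflectAt_update, reflect, mul_sub, Finset.sum_sub_distrib, ← mul_assoc, ← Finset.sum_mul,
    hv']
  rw [reflectAt_apply]
  ring

theorem sum_norm_sq_reflectAt [Fintype ι] [Nonempty α] {v : α → ℝ} (hv : ∑ y, v y ^ 2 = 2) (j : ι)
    (s : (ι → α) → ℂ) : ∑ D, ‖reflectAt v j s D‖ ^ 2 = ∑ D, ‖s D‖ ^ 2 := by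
  have h : ∀ D, ∑ y, ‖reflectAt v j s (Function.update D j y)‖ ^ 2
      = ∑ y, ‖s (Function.update D j y)‖ ^ 2 := by
    intro D
    simp only [reflectAt_update]
    exact sum_norm_sq_reflect hv fun y => s (Function.update D j y)
  exact le_antisymm (sum_le_sum_of_update j fun D => (h D).le)
    (sum_le_sum_of_update j fun D => (h D).ge)

/-- `reflectAt v j` commutes with multiplication by a function that ignores the coordinate `j`. -/
theorem reflectAt_mul {v : α → ℝ} {j : ι} {h : (ι → α) → ℂ}
    (hh : ∀ D y, h (Function.update D j y) = h D) (s : (ι → α) → ℂ) :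
    reflectAt v j (h * s) = h * reflectAt v j s := by
  ext D
  simp only [reflectAt_apply, Pi.mul_apply, hh, mul_sub, Finset.mul_sum]
  congr 1
  exact Finset.sum_congr rfl fun y _ => by ring

theorem pairwise_commute_reflectAt (v : α → ℝ) (J : Finset ι) :
    (J : Set ι).Pairwise (Function.onFun Commute (reflectAt v)) :=
  fun i _ j _ _ => reflectAt_commute v i j

/-- The reflection `1 - v vᵀ` applied to all tensor factors in `J`. -/
def reflectOn (v : α → ℝ) (J : Finset ι) : Module.End ℂ ((ι → α) → ℂ) :=
  J.noncommProd (reflectAt v) (pairwise_commute_reflectAt v J)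

theorem reflectOn_empty (v : α → ℝ) (s : (ι → α) → ℂ) : reflectOn v ∅ s = s := by
  simp [reflectOn]

theorem reflectOn_insert (v : α → ℝ) {J : Finset ι} {j : ι} (hj : j ∉ J) (s : (ι → α) → ℂ) :
    reflectOn v (insert j J) s = reflectAt v j (reflectOn v J s) := by
  rw [reflectOn, Finset.noncommProd_insert_of_notMem _ _ _ _ hj]
  rfl

theorem reflectOn_insert' (v : α → ℝ) {J : Finset ι} {j : ι} (hj : j ∉ J) (s : (ι → α) → ℂ) :
    reflectOn v (insert j J) s = reflectOn v J (reflectAt v j s) := by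
  rw [reflectOn, Finset.noncommProd_insert_of_notMem' _ _ _ _ hj]
  rfl

theorem reflectOn_union (v : α → ℝ) {J L : Finset ι} (h : Disjoint J L) (s : (ι → α) → ℂ) :
    reflectOn v (J ∪ L) s = reflectOn v J (reflectOn v L s) := by
  rw [reflectOn, Finset.noncommProd_union_of_disjoint h]
  rfl

theorem sum_norm_sq_reflectOn [Fintype ι] [Nonempty α] {v : α → ℝ} (hv : ∑ y, v y ^ 2 = 2) (J : Finset ι)
    (s : (ι → α) → ℂ) : ∑ D, ‖reflectOn v J s D‖ ^ 2 = ∑ D, ‖s D‖ ^ 2 := by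
  induction J using Finset.induction_on with
  | empty => rw [reflectOn_empty]
  | insert j J hj ih => rw [reflectOn_insert v hj, sum_norm_sq_reflectAt hv, ih]

theorem reflectOn_mul {v : α → ℝ} {J : Finset ι} {h : (ι → α) → ℂ}
    (hh : ∀ j ∈ J, ∀ D y, h (Function.update D j y) = h D) (s : (ι → α) → ℂ) :
    reflectOn v J (h * s) = h * reflectOn v J s := by
  induction J using Finset.induction_on with
  | empty => simp only [reflectOn_empty]
  | insert j J hj ih =>
    rw [reflectOn_insert v hj, reflectOn_insert v hj,
      ih fun i hi => hh i (Finset.mem_insert_of_mem hi),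
      reflectAt_mul (hh j (Finset.mem_insert_self j J))]

/-- Conjugating a multiplication operator on the factor `x` by all the reflections amounts to
conjugating it by the reflection of that factor. -/
theorem reflectOn_conj [Fintype ι] {v : α → ℝ} (hv : ∑ y, v y ^ 2 = 2) (x : ι) (g : α → ℂ)
    (s : (ι → α) → ℂ) :
    reflectOn v Finset.univ (reflectAt v x ((fun D => g (D x)) * reflectAt v x s))
      = (fun D => g (D x)) * reflectOn v Finset.univ s := by
  -- The reflection at `x` is taken innermost, where it cancels the outer one of the conjugation;
  -- the others act on registers that `g (D x)` ignores.
  have hx : x ∉ Finset.univ.erase x := Finset.notMem_erase x _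
  rw [← Finset.insert_erase (Finset.mem_univ x), reflectOn_insert' v hx, reflectOn_insert' v hx,
    reflectAt_reflectAt hv, reflectOn_mul]
  intro j hj D y
  rw [Function.update_of_ne (Finset.ne_of_mem_erase hj).symm]

end Reflections

/-! ### Estimates on one or two registers. -/

section FiberEstimates

theorem norm_add_sq_le_two_mul (a b : ℂ) : ‖a + b‖ ^ 2 ≤ 2 * ‖a‖ ^ 2 + 2 * ‖b‖ ^ 2 := by
  have h := norm_add_le a b
  have h0 := norm_nonneg (a + b)
  nlinarith [sq_nonneg (‖a‖ - ‖b‖)]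

/-- Conjugating multiplication by `g` by the reflection `1 - v vᵀ` moves little mass from the
complement of `Y` into `Y`, if `v` is small on `Y`. -/
theorem sum_norm_sq_reflect_conj_le {α : Type*} [Fintype α] {v : α → ℝ}
    (hv : ∑ y, v y ^ 2 = 2) {g : α → ℂ} (hg : ∀ y, ‖g y‖ ≤ 1) {Y : Finset α} {c : ℝ}
    (hY : ∀ y ∈ Y, v y ^ 2 ≤ c) {s : α → ℂ} (hs : ∀ y ∈ Y, s y = 0) :
    ∑ y ∈ Y, ‖reflect v (fun z => g z * reflect v s z) y‖ ^ 2
      ≤ Y.card * (8 * c * ∑ y, ‖s y‖ ^ 2) := by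
  rw [← nsmul_eq_mul]
  refine Finset.sum_le_card_nsmul _ _ _ fun y hy => ?_
  set A := ∑ y, ‖s y‖ ^ 2 with hA
  set a := ∑ z, (v z : ℂ) * s z with ha
  set b := ∑ z, (v z : ℂ) * (g z * reflect v s z) with hb
  -- Since `s` vanishes at `y`, only the two rank-one corrections survive, and both carry the factor
  -- `v y`.
  have h1 : reflect v (fun z => g z * reflect v s z) y = -(v y : ℂ) * (g y * a + b) := by
    simp only [reflect, hs y hy, ← ha]
    rw [hb]
    simp only [reflect, ← ha]
    ring
  have h2 : ‖a‖ ^ 2 ≤ 2 * A := by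
    rw [ha, hA, ← hv]
    exact norm_sum_mul_sq_le v s
  have h3 : ‖b‖ ^ 2 ≤ 2 * A := by
    calc ‖b‖ ^ 2 ≤ 2 * ∑ z, ‖g z * reflect v s z‖ ^ 2 := by
          rw [hb, ← hv]
          exact norm_sum_mul_sq_le v _
      _ ≤ 2 * ∑ z, ‖reflect v s z‖ ^ 2 := by
          gcongr with z
          rw [norm_mul]
          exact mul_le_of_le_one_left (norm_nonneg _) (hg z)
      _ = 2 * A := by rw [sum_norm_sq_reflect hv]
  have h4 : ‖g y * a‖ ^ 2 ≤ ‖a‖ ^ 2 := by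
    gcongr
    rw [norm_mul]
    exact mul_le_of_le_one_left (norm_nonneg _) (hg y)
  have h5 := norm_add_sq_le_two_mul (g y * a) b
  rw [h1, norm_mul, mul_pow, norm_neg, Complex.norm_real, Real.norm_eq_abs, sq_abs]
  calc v y ^ 2 * ‖g y * a + b‖ ^ 2 ≤ c * (8 * A) := by
        gcongr
        · exact (sq_nonneg _).trans (hY y hy)
        · exact hY y hy
        · linarith
    _ = 8 * c * A := by ring

/-- The difference of `|⊥⟩` and the uniform superposition of the `|y⟩`. -/
def bottomSubUniform (N : ℕ) : Option (Fin N) → ℝ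
  | none => 1
  | some _ => -(1 / √N)

theorem bottomSubUniform_some_sq {N : ℕ} (y : Fin N) :
    bottomSubUniform N (some y) ^ 2 = 1 / N := by
  simp [bottomSubUniform]

theorem sum_bottomSubUniform_sq {N : ℕ} (hN : 0 < N) :
    ∑ y, bottomSubUniform N y ^ 2 = 2 := by
  have : (N : ℝ) ≠ 0 := by positivity
  rw [Fintype.sum_option]
  simp only [bottomSubUniform_some_sq]
  simp [bottomSubUniform, this]
  norm_num

/-- The operator `(1 - v vᵀ) ⊗ (1 - v vᵀ)`. -/
def reflectPair {α : Type*} [Fintype α] (v : α → ℝ) (s : α → α → ℂ) (y z : α) : ℂ :=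
  reflect v (fun z' => reflect v (fun y' => s y' z') y) z

theorem reflectPair_add {α : Type*} [Fintype α] (v : α → ℝ) (s r : α → α → ℂ) (y z : α) :
    reflectPair v (fun y z => s y z + r y z) y z = reflectPair v s y z + reflectPair v r y z := by
  simp only [reflectPair, reflect_add]

theorem sum_norm_sq_reflectPair {α : Type*} [Fintype α] {v : α → ℝ} (hv : ∑ y, v y ^ 2 = 2)
    (s : α → α → ℂ) : ∑ y, ∑ z, ‖reflectPair v s y z‖ ^ 2 = ∑ y, ∑ z, ‖s y z‖ ^ 2 := by
  simp only [reflectPair, sum_norm_sq_reflect hv]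
  rw [Finset.sum_comm]
  simp only [sum_norm_sq_reflect hv]
  rw [Finset.sum_comm]

theorem norm_add_three_sq_le (a b c : ℂ) :
    ‖a + b + c‖ ^ 2 ≤ 3 * (‖a‖ ^ 2 + ‖b‖ ^ 2 + ‖c‖ ^ 2) := by
  have h := norm_add₃_le (a := a) (b := b) (c := c)
  have h0 := norm_nonneg (a + b + c)
  nlinarith [sq_nonneg (‖a‖ - ‖b‖), sq_nonneg (‖a‖ - ‖c‖), sq_nonneg (‖b‖ - ‖c‖)]

/-- On the diagonal the identity term of the product of two reflections vanishes. The three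
remaining terms each contain `v (some y)`, whose square is `1/N`. Cauchy–Schwarz bounds their sums
by `2A`, `2A` and `4A`, hence `24 = 3 * (2 + 2 + 4)`. -/
theorem sum_norm_sq_reflectPair_diag_le_of_eq_zero {N : ℕ} (hN : 0 < N)
    {s : Option (Fin N) → Option (Fin N) → ℂ} (hs : ∀ y, s (some y) (some y) = 0) :
    ∑ y, ‖reflectPair (bottomSubUniform N) s (some y) (some y)‖ ^ 2
      ≤ 24 / N * ∑ y, ∑ z, ‖s y z‖ ^ 2 := by
  set v := bottomSubUniform N with hvdef
  have hv : ∑ y, v y ^ 2 = 2 := sum_bottomSubUniform_sq hN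
  have hN0 : (0 : ℝ) < N := by exact_mod_cast hN
  set A := ∑ y, ∑ z, ‖s y z‖ ^ 2 with hA
  set a : Option (Fin N) → ℂ := fun z => ∑ y, (v y : ℂ) * s y z with ha
  set b : Option (Fin N) → ℂ := fun y => ∑ z, (v z : ℂ) * s y z with hb
  set c : ℂ := ∑ z, (v z : ℂ) * a z with hc
  have hsa : ∑ z, ‖a z‖ ^ 2 ≤ 2 * A := by
    rw [hA, Finset.sum_comm, Finset.mul_sum]
    refine Finset.sum_le_sum fun z _ => ?_
    rw [← hv]
    exact norm_sum_mul_sq_le v fun y => s y z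
  have hsb : ∑ y, ‖b y‖ ^ 2 ≤ 2 * A := by
    rw [hA, Finset.mul_sum]
    refine Finset.sum_le_sum fun y _ => ?_
    rw [← hv]
    exact norm_sum_mul_sq_le v fun z => s y z
  have hcc : ‖c‖ ^ 2 ≤ 4 * A := by
    have := norm_sum_mul_sq_le v a
    rw [hv] at this
    linarith
  have hsub : ∀ f : Option (Fin N) → ℝ, (∀ y, 0 ≤ f y) → ∑ y : Fin N, f (some y) ≤ ∑ y, f y := by
    intro f hf
    rw [Fintype.sum_option]
    linarith [hf none]
  have key : ∀ y : Fin N, ‖reflectPair v s (some y) (some y)‖ ^ 2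
      ≤ 3 / N * ‖a (some y)‖ ^ 2 + 3 / N * ‖b (some y)‖ ^ 2 + 3 / N ^ 2 * ‖c‖ ^ 2 := by
    intro y
    have h1 : reflectPair v s (some y) (some y)
        = -(v (some y) : ℂ) * a (some y) + -(v (some y) : ℂ) * b (some y)
          + ((v (some y) ^ 2 : ℝ) : ℂ) * c := by
      simp only [reflectPair, reflect, hs]
      rw [hc]
      simp only [mul_sub, Finset.sum_sub_distrib, ha, hb]
      have : ∑ x, (v x : ℂ) * ((v (some y) : ℂ) * ∑ z, (v z : ℂ) * s z x)
          = v (some y) * ∑ x, (v x : ℂ) * ∑ z, (v z : ℂ) * s z x := by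
        rw [Finset.mul_sum]
        exact Finset.sum_congr rfl fun x _ => by ring
      rw [this]
      push_cast
      ring
    rw [h1]
    refine (norm_add_three_sq_le _ _ _).trans (le_of_eq ?_)
    simp only [norm_mul, mul_pow, norm_neg, Complex.norm_real, Real.norm_eq_abs, sq_abs,
      bottomSubUniform_some_sq, hvdef]
    ring
  calc _ ≤ ∑ y : Fin N, (3 / N * ‖a (some y)‖ ^ 2 + 3 / N * ‖b (some y)‖ ^ 2
        + 3 / N ^ 2 * ‖c‖ ^ 2) := Finset.sum_le_sum fun y _ => key y
    _ = 3 / N * ∑ y, ‖a (some y)‖ ^ 2 + 3 / N * ∑ y, ‖b (some y)‖ ^ 2 + 3 / N * ‖c‖ ^ 2 := by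
        simp only [Finset.sum_add_distrib, ← Finset.mul_sum, Finset.sum_const, Finset.card_univ,
          Fintype.card_fin, nsmul_eq_mul]
        field_simp
    _ ≤ 3 / N * (2 * A) + 3 / N * (2 * A) + 3 / N * (4 * A) := by
        gcongr
        · exact (hsub _ fun _ => sq_nonneg _).trans hsa
        · exact (hsub _ fun _ => sq_nonneg _).trans hsb
    _ = 24 / N * A := by ring

/-- The entries `y` and `z` of a database are recorded and equal. -/
abbrev Collide {N : ℕ} (y z : Option (Fin N)) : Prop := ∃ w, y = some w ∧ z = some w

theorem sum_sum_ite_collide {N : ℕ} (F : Option (Fin N) → Option (Fin N) → ℝ) :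
    ∑ y, ∑ z, (if Collide y z then F y z else 0) = ∑ y, F (some y) (some y) := by
  simp [Fintype.sum_option, Collide]

/-- The state splits into its colliding part, which loses nothing under a unitary, and the rest,
which gains a collision only with weight `24/N`. The factor `2` pays for the splitting. -/
theorem sum_norm_sq_reflectPair_collide_le {N : ℕ} (hN : 0 < N)
    (s : Option (Fin N) → Option (Fin N) → ℂ) :
    ∑ y, ∑ z, (if Collide y z then ‖reflectPair (bottomSubUniform N) s y z‖ ^ 2 else 0)
      ≤ ∑ y, ∑ z, 2 * (if Collide y z then 1 else (24 / N : ℝ)) * ‖s y z‖ ^ 2 := by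
  set v := bottomSubUniform N with hvdef
  have hv : ∑ y, v y ^ 2 = 2 := sum_bottomSubUniform_sq hN
  set s₁ : Option (Fin N) → Option (Fin N) → ℂ := fun y z => if Collide y z then s y z else 0
    with h1
  set s₂ : Option (Fin N) → Option (Fin N) → ℂ := fun y z => if Collide y z then 0 else s y z
    with h2
  have hs : s = fun y z => s₁ y z + s₂ y z := by
    ext y z
    by_cases h : Collide y z <;> simp [h1, h2, h]
  have hb1 : ∑ y, ‖reflectPair v s₁ (some y) (some y)‖ ^ 2 ≤ ∑ y, ∑ z, ‖s₁ y z‖ ^ 2 := by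
    rw [← sum_norm_sq_reflectPair hv, ← sum_sum_ite_collide fun y z => ‖reflectPair v s₁ y z‖ ^ 2]
    refine Finset.sum_le_sum fun y _ => Finset.sum_le_sum fun z _ => ?_
    split_ifs
    · rfl
    · positivity
  have hb2 := sum_norm_sq_reflectPair_diag_le_of_eq_zero hN (s := s₂) fun y => by simp [h2]
  rw [sum_sum_ite_collide fun y z => ‖reflectPair v s y z‖ ^ 2]
  calc ∑ y, ‖reflectPair v s (some y) (some y)‖ ^ 2
      ≤ ∑ y, (2 * ‖reflectPair v s₁ (some y) (some y)‖ ^ 2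
          + 2 * ‖reflectPair v s₂ (some y) (some y)‖ ^ 2) := by
        refine Finset.sum_le_sum fun y _ => ?_
        rw [hs, reflectPair_add]
        exact norm_add_sq_le_two_mul _ _
    _ ≤ 2 * ∑ y, ∑ z, ‖s₁ y z‖ ^ 2 + 2 * (24 / N * ∑ y, ∑ z, ‖s₂ y z‖ ^ 2) := by
        rw [Finset.sum_add_distrib, ← Finset.mul_sum, ← Finset.mul_sum]
        gcongr
    _ = _ := by
        simp only [Finset.mul_sum, ← Finset.sum_add_distrib]
        refine Finset.sum_congr rfl fun y _ => Finset.sum_congr rfl fun z _ => ?_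
        by_cases h : Collide y z
        · simp [h1, h2, h]
        · simp [h1, h2, h]
          ring

end FiberEstimates

/-! ### Databases, their excess, and guessing unrecorded collisions. -/

section Databases

variable {M N K : ℕ}

/-- Partial functions from `[M]` to `[N]`. -/
abbrev Database (M N : ℕ) : Type := Fin M → Option (Fin N)

namespace Database

/-- The set of inputs recorded in the database. -/
def domain (D : Database M N) : Finset (Fin M) := Finset.univ.filter fun x => D x ≠ none

/-- The set of outputs recorded in the database. -/
def range (D : Database M N) : Finset (Option (Fin N)) := D.domain.image D

/-- The number of recorded inputs in excess of the number of recorded outputs. -/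
def excess (D : Database M N) : ℕ := D.domain.card - D.range.card

/-- This makes the truncated subtraction in `excess` a true difference. -/
theorem range_card_le (D : Database M N) : D.range.card ≤ D.domain.card := Finset.card_image_le

theorem mem_domain {D : Database M N} {x : Fin M} : x ∈ D.domain ↔ D x ≠ none := by
  simp [domain]

theorem domain_update_some (D : Database M N) (x : Fin M) (y : Fin N) :
    domain (Function.update D x (some y)) = insert x (domain (Function.update D x none)) := by
  ext z
  rcases eq_or_ne z x with rfl | h
  · simp [mem_domain]
  · simp [mem_domain, h]

theorem notMem_domain_update_none (D : Database M N) (x : Fin M) :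
    x ∉ domain (Function.update D x none) := by
  simp [mem_domain]

theorem range_update_some (D : Database M N) (x : Fin M) (y : Fin N) :
    range (Function.update D x (some y))
      = insert (some y) (range (Function.update D x none)) := by
  rw [range, domain_update_some, Finset.image_insert, Function.update_self, range]
  congr 1
  refine Finset.image_congr fun z hz => ?_
  have : z ≠ x := by
    rintro rfl
    exact notMem_domain_update_none D z hz
  simp [this]

theorem card_domain_update_none_le (D : Database M N) (x : Fin M) (y : Option (Fin N)) :
    (domain (Function.update D x none)).card ≤ (domain (Function.update D x y)).card := by
  cases y with
  | none => rfl
  | some y =>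
    rw [domain_update_some]
    exact Finset.card_le_card (Finset.subset_insert _ _)

theorem card_domain_update_le (D : Database M N) (x : Fin M) (y : Option (Fin N)) :
    (domain (Function.update D x y)).card ≤ (domain (Function.update D x none)).card + 1 := by
  cases y with
  | none => exact Nat.le_succ _
  | some y =>
    rw [domain_update_some]
    exact Finset.card_insert_le _ _

/-- Recording a value increases the excess by one if this value was recorded already. -/
theorem excess_update_some (D : Database M N) (x : Fin M) (y : Fin N) :
    excess (Function.update D x (some y)) = excess (Function.update D x none)
      + if some y ∈ range (Function.update D x none) then 1 else 0 := by
  have h := range_card_le (Function.update D x none)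
  rw [excess, domain_update_some, range_update_some,
    Finset.card_insert_of_notMem (notMem_domain_update_none D x), excess]
  split_ifs with hy
  · rw [Finset.insert_eq_of_mem hy]
    omega
  · rw [Finset.card_insert_of_notMem hy]
    omega

theorem excess_update_none_le (D : Database M N) (x : Fin M) (y : Option (Fin N)) :
    excess (Function.update D x none) ≤ excess (Function.update D x y) := by
  cases y with
  | none => rfl
  | some y =>
    rw [excess_update_some]
    exact Nat.le_add_right _ _

theorem excess_update_le (D : Database M N) (x : Fin M) (y : Option (Fin N)) :
    excess (Function.update D x y) ≤ excess (Function.update D x none) + 1 := by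
  cases y with
  | none => exact Nat.le_succ _
  | some y =>
    rw [excess_update_some]
    split_ifs <;> omega

end Database

/-- A list of pairs, all of whose entries are different. -/
def PairsDistinct (z : Fin K → Fin M × Fin M) : Prop :=
  (∀ i, (z i).1 ≠ (z i).2) ∧ ∀ i j, i ≠ j → DisjointPairs (z i) (z j)

/-- The number of disjoint collisions contained in a database is at most its excess. -/
theorem card_collide_le_excess {z : Fin K → Fin M × Fin M} (hz : PairsDistinct z)
    (D : Database M N) :
    (Finset.univ.filter fun i => Collide (D (z i).1) (D (z i).2)).card ≤ D.excess := by
  set I := Finset.univ.filter fun i => Collide (D (z i).1) (D (z i).2) with hI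
  set B := I.image fun i => (z i).2 with hB
  have hcard : B.card = I.card := by
    refine Finset.card_image_of_injective _ fun i j hij => ?_
    by_contra hne
    exact (hz.2 i j hne).2.2.2 hij
  have hBD : B ⊆ D.domain := by
    intro x hx
    obtain ⟨i, hi, rfl⟩ := Finset.mem_image.1 hx
    obtain ⟨w, -, hw⟩ := (Finset.mem_filter.1 hi).2
    simp [Database.mem_domain, hw]
  -- Dropping the second entries of the colliding pairs loses no output, because each first entry
  -- stays and carries the same value.
  have hrange : D.range ⊆ (D.domain \ B).image D := by
    intro y hy
    obtain ⟨x, hx, rfl⟩ := Finset.mem_image.1 hy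
    by_cases hxB : x ∈ B
    · obtain ⟨i, hi, rfl⟩ := Finset.mem_image.1 hxB
      obtain ⟨w, hw1, hw2⟩ := (Finset.mem_filter.1 hi).2
      refine Finset.mem_image.2 ⟨(z i).1, Finset.mem_sdiff.2 ⟨?_, ?_⟩, hw1.trans hw2.symm⟩
      · simp [Database.mem_domain, hw1]
      · intro h
        obtain ⟨j, -, hj⟩ := Finset.mem_image.1 h
        rcases eq_or_ne i j with rfl | hij
        · exact hz.1 i hj.symm
        · exact (hz.2 i j hij).2.1 hj.symm
    · exact Finset.mem_image_of_mem _ (Finset.mem_sdiff.2 ⟨hx, hxB⟩)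
  have h1 := (Finset.card_le_card hrange).trans Finset.card_image_le
  rw [Finset.card_sdiff_of_subset hBD, hcard] at h1
  have h2 := Finset.card_le_card hBD
  rw [Database.excess]
  omega

/-- The entries of the pairs with index in `I`. -/
def entries (z : Fin K → Fin M × Fin M) (I : Finset (Fin K)) : Finset (Fin M) :=
  I.biUnion fun i => {(z i).1, (z i).2}

theorem entries_insert (z : Fin K → Fin M × Fin M) (I : Finset (Fin K)) (i : Fin K) :
    entries z (insert i I) = insert (z i).1 (insert (z i).2 (entries z I)) := by
  rw [entries, Finset.biUnion_insert, entries, Finset.insert_union, Finset.singleton_union]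

theorem fst_notMem_entries {z : Fin K → Fin M × Fin M} (hz : PairsDistinct z)
    {I : Finset (Fin K)} {i : Fin K} (hi : i ∉ I) : (z i).1 ∉ entries z I := by
  simp only [entries, Finset.mem_biUnion, Finset.mem_insert, Finset.mem_singleton, not_exists,
    not_and, not_or]
  intro j hj
  have := hz.2 i j (by rintro rfl; exact hi hj)
  exact ⟨this.1, this.2.1⟩

theorem snd_notMem_entries {z : Fin K → Fin M × Fin M} (hz : PairsDistinct z)
    {I : Finset (Fin K)} {i : Fin K} (hi : i ∉ I) : (z i).2 ∉ entries z I := by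
  simp only [entries, Finset.mem_biUnion, Finset.mem_insert, Finset.mem_singleton, not_exists,
    not_and, not_or]
  intro j hj
  have := hz.2 i j (by rintro rfl; exact hi hj)
  exact ⟨this.2.2.1, this.2.2.2⟩

theorem reflectAt_reflectAt_update {ι α : Type*} [DecidableEq ι] [Fintype α] (v : α → ℝ)
    {i j : ι} (hij : i ≠ j) (s : (ι → α) → ℂ) (D : ι → α) (y z : α) :
    reflectAt v j (reflectAt v i s) (Function.update (Function.update D i y) j z)
      = reflectPair v (fun y z => s (Function.update (Function.update D i y) j z)) y z := by
  rw [reflectAt_update, reflectPair]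
  congr 1
  ext z'
  rw [Function.update_comm hij, reflectAt_update]
  congr 1
  ext y'
  rw [Function.update_comm hij]

/-- Weight of a pair of a database in the estimate for the probability of guessing collisions. -/
def pairWeight (D : Database M N) (c : Fin M × Fin M) : ℝ :=
  2 * if Collide (D c.1) (D c.2) then 1 else (24 / N : ℝ)

theorem pairWeight_nonneg (D : Database M N) (c : Fin M × Fin M) : 0 ≤ pairWeight D c := by
  rw [pairWeight]
  positivity

/-- The pairs occupy disjoint registers, so they can be peeled off one at a time: the collision test
of one pair commutes with the reflections of the others, and the two-register estimate contributes
one weight per pair. -/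
theorem sum_norm_sq_reflectOn_entries_le (hN : 0 < N) {z : Fin K → Fin M × Fin M}
    (hz : PairsDistinct z) (I : Finset (Fin K)) (s : Database M N → ℂ) :
    ∑ D : Database M N, (if ∀ i ∈ I, Collide (D (z i).1) (D (z i).2) then
        ‖reflectOn (bottomSubUniform N) (entries z I) s D‖ ^ 2 else 0)
      ≤ ∑ D, (∏ i ∈ I, pairWeight D (z i)) * ‖s D‖ ^ 2 := by
  set v := bottomSubUniform N with hv
  induction I using Finset.induction_on generalizing s with
  | empty => simp [entries, reflectOn_empty]
  | insert i I hi ih =>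
    have hne := hz.1 i
    have h1 : (z i).1 ∉ insert (z i).2 (entries z I) := by
      simp [hne, fst_notMem_entries hz hi]
    set r := reflectAt v (z i).2 (reflectAt v (z i).1 s) with hr
    set h : Database M N → ℂ := fun D => if Collide (D (z i).1) (D (z i).2) then 1 else 0 with hh
    have hcomm : reflectOn v (entries z I) (h * r) = h * reflectOn v (entries z I) r := by
      refine reflectOn_mul (v := v) (fun j hj D y => ?_) r
      have hj1 : (z i).1 ≠ j := by rintro rfl; exact fst_notMem_entries hz hi hj
      have hj2 : (z i).2 ≠ j := by rintro rfl; exact snd_notMem_entries hz hi hj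
      simp [hh, hj1, hj2]
    have hop : reflectOn v (entries z (insert i I)) s = reflectOn v (entries z I) r := by
      rw [entries_insert, reflectOn_insert' v h1, reflectOn_insert' v (snd_notMem_entries hz hi)]
    calc _ = ∑ D : Database M N, (if ∀ i ∈ I, Collide (D (z i).1) (D (z i).2) then
        ‖reflectOn v (entries z I) (h * r) D‖ ^ 2 else 0) := by
          refine Finset.sum_congr rfl fun D _ => ?_
          rw [hop, hcomm]
          by_cases hc : Collide (D (z i).1) (D (z i).2)
          · simp only [Finset.forall_mem_insert, hc, true_and, hh, Pi.mul_apply, if_true, one_mul]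
          · simp only [Finset.forall_mem_insert, hc, false_and, hh, Pi.mul_apply, if_false,
              zero_mul]
            simp
      _ ≤ ∑ D, (∏ i ∈ I, pairWeight D (z i)) * ‖(h * r) D‖ ^ 2 := ih _
      _ ≤ _ := by
          refine sum_le_sum_of_update₂ (z i).1 (z i).2 fun D => ?_
          have hw : ∀ y y', ∏ j ∈ I, pairWeight
              (Function.update (Function.update D (z i).1 y) (z i).2 y') (z j)
              = ∏ j ∈ I, pairWeight D (z j) := by
            intro y y'
            refine Finset.prod_congr rfl fun j hj => ?_
            obtain ⟨e1, e2, e3, e4⟩ := hz.2 j i (by rintro rfl; exact hi hj)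
            simp [pairWeight, e1, e2, e3, e4]
          simp only [Finset.prod_insert hi, hw, mul_assoc, mul_left_comm (pairWeight _ (z i)),
            ← Finset.mul_sum]
          refine mul_le_mul_of_nonneg_left ?_ (Finset.prod_nonneg fun j _ => pairWeight_nonneg _ _)
          have hl : ∀ y y', ‖(h * r) (Function.update (Function.update D (z i).1 y) (z i).2 y')‖ ^ 2
              = if Collide y y' then ‖reflectPair v (fun y y' =>
                s (Function.update (Function.update D (z i).1 y) (z i).2 y')) y y'‖ ^ 2 else 0 := by
            intro y y'
            rw [Pi.mul_apply, hr, reflectAt_reflectAt_update v hne]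
            simp only [hh, Function.update_self, Function.update_of_ne hne]
            by_cases hc : Collide y y'
            · simp only [hc, if_true, one_mul]
            · simp only [hc, if_false, zero_mul, norm_zero]
              norm_num
          have hw' : ∀ y y', pairWeight
              (Function.update (Function.update D (z i).1 y) (z i).2 y') (z i)
              = 2 * if Collide y y' then 1 else (24 / N : ℝ) := by
            intro y y'
            simp only [pairWeight, Function.update_self, Function.update_of_ne hne]
          simp only [hl, hw']
          exact sum_norm_sq_reflectPair_collide_le hN _

/-- A state on databases with few recorded collisions has a small probability of yielding
collisions at given pairs. -/
theorem sum_norm_sq_reflectOn_collide_le (hN : 1536 ≤ N) {z : Fin K → Fin M × Fin M}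
    (hz : PairsDistinct z) (s : Database M N → ℂ) (hs : ∀ D, (K + 1) / 2 ≤ D.excess → s D = 0) :
    ∑ D : Database M N, (if ∀ i, Collide (D (z i).1) (D (z i).2) then
        ‖reflectOn (bottomSubUniform N) Finset.univ s D‖ ^ 2 else 0)
      ≤ (1 / 4) ^ K * ∑ D, ‖s D‖ ^ 2 := by
  set v := bottomSubUniform N
  have hN0 : 0 < N := by omega
  have hv : ∑ y, v y ^ 2 = 2 := sum_bottomSubUniform_sq hN0
  set E := entries z Finset.univ with hE
  set h : Database M N → ℂ := fun D => if ∀ i, Collide (D (z i).1) (D (z i).2) then 1 else 0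
    with hh
  -- Reflections outside the output pairs commute with the collision test and preserve norms, so
  -- only those on `E` matter.
  have hcomm : reflectOn v (Finset.univ \ E) (h * reflectOn v E s)
      = h * reflectOn v Finset.univ s := by
    rw [reflectOn_mul, ← reflectOn_union v (Finset.sdiff_disjoint (s := E) (t := Finset.univ)),
      Finset.sdiff_union_of_subset (Finset.subset_univ E)]
    intro j hj D y
    have hj' : ∀ i, (z i).1 ≠ j ∧ (z i).2 ≠ j := by
      intro i
      have hjE := (Finset.mem_sdiff.1 hj).2
      simp only [hE, entries, Finset.mem_biUnion, not_exists, not_and] at hjE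
      have := hjE i (Finset.mem_univ _)
      simp only [Finset.mem_insert, Finset.mem_singleton, not_or] at this
      exact ⟨Ne.symm this.1, Ne.symm this.2⟩
    simp only [hh, Function.update_of_ne (hj' _).1, Function.update_of_ne (hj' _).2]
  have hind : ∀ (r : Database M N → ℂ) (D : Database M N),
      (if ∀ i, Collide (D (z i).1) (D (z i).2) then ‖r D‖ ^ 2 else 0) = ‖(h * r) D‖ ^ 2 := by
    intro r D
    simp only [hh, Pi.mul_apply]
    split_ifs <;> simp
  simp only [hind]
  rw [← hcomm, sum_norm_sq_reflectOn hv]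
  simp only [← hind]
  have := sum_norm_sq_reflectOn_entries_le hN0 hz Finset.univ s
  simp only [Finset.mem_univ, true_imp_iff] at this
  refine this.trans ?_
  rw [Finset.mul_sum]
  refine Finset.sum_le_sum fun D _ => ?_
  by_cases hD : (K + 1) / 2 ≤ D.excess
  · simp [hs D hD]
  gcongr
  have hcol := card_collide_le_excess hz D
  -- The threshold is `1536 = 24 * 64`; the square root `1/8` of `1/64` then beats the factor `2`
  -- per pair.
  have hN' : (24 / N : ℝ) ≤ 1 / 64 := by
    rw [div_le_div_iff₀ (by positivity) (by norm_num)]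
    have : (1536 : ℝ) ≤ N := by exact_mod_cast hN
    linarith
  have hsum := Finset.card_filter_add_card_filter_not (s := (Finset.univ : Finset (Fin K)))
    (fun i => Collide (D (z i).1) (D (z i).2))
  rw [Finset.card_univ, Fintype.card_fin] at hsum
  simp only [pairWeight, Finset.prod_mul_distrib, Finset.prod_const, Finset.card_univ,
    Fintype.card_fin, Finset.prod_ite, one_pow, one_mul]
  set a := (Finset.univ.filter fun i => Collide (D (z i).1) (D (z i).2)).card
  set b := (Finset.univ.filter fun i => ¬ Collide (D (z i).1) (D (z i).2)).card
  calc (2 : ℝ) ^ K * (24 / N) ^ b ≤ 2 ^ K * (1 / 64) ^ b := by gcongr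
    _ = 2 ^ K * (1 / 8) ^ (2 * b) := by rw [pow_mul]; norm_num
    _ ≤ 2 ^ K * (1 / 8) ^ K := by
        gcongr 2 ^ K * ?_
        -- Fewer than `⌈K/2⌉` pairs collide, so `2 * b ≥ K`.
        exact pow_le_pow_of_le_one (by norm_num) (by norm_num) (by omega)
    _ = (1 / 4) ^ K := by rw [← mul_pow]; norm_num

end Databases

/-! ### Recording queries and the growth of the excess. -/

section Recording

theorem sqrt_sum_norm_add_sq_le {κ : Type*} [Fintype κ] (u w : κ → ℂ) :
    √(∑ i, ‖u i + w i‖ ^ 2) ≤ √(∑ i, ‖u i‖ ^ 2) + √(∑ i, ‖w i‖ ^ 2) := by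
  have h := norm_add_le (WithLp.toLp 2 u : EuclideanSpace ℂ κ) (WithLp.toLp 2 w)
  simpa only [EuclideanSpace.norm_eq, PiLp.add_apply] using h

variable {M N T : ℕ}

/-- The recording version of the phase oracle on the query `x`: the reflection of the register
`x`, multiplication by the phase, and the reflection again. -/
def recordPhase (x : Fin M) (g : Option (Fin N) → ℂ) (s : Database M N → ℂ) : Database M N → ℂ :=
  reflectAt (bottomSubUniform N) x ((fun D => g (D x)) * reflectAt (bottomSubUniform N) x s)

theorem recordPhase_add (x : Fin M) (g : Option (Fin N) → ℂ) (s r : Database M N → ℂ) :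
    recordPhase x g (s + r) = recordPhase x g s + recordPhase x g r := by
  simp only [recordPhase, map_add, mul_add]

theorem recordPhase_update (x : Fin M) (g : Option (Fin N) → ℂ) (s : Database M N → ℂ)
    (D : Database M N) (y : Option (Fin N)) :
    recordPhase x g s (Function.update D x y) = reflect (bottomSubUniform N)
      (fun z => g z * reflect (bottomSubUniform N) (fun z => s (Function.update D x z)) z) y := by
  rw [recordPhase, reflectAt_update]
  congr 1
  ext z
  rw [Pi.mul_apply, Function.update_self, reflectAt_update]

theorem recordPhase_update_eq_zero {x : Fin M} {g : Option (Fin N) → ℂ} {s : Database M N → ℂ}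
    {D : Database M N} (h : ∀ y, s (Function.update D x y) = 0) (y : Option (Fin N)) :
    recordPhase x g s (Function.update D x y) = 0 := by
  rw [recordPhase_update]
  simp [h, reflect]

theorem sum_norm_sq_recordPhase_le (hN : 0 < N) (x : Fin M) {g : Option (Fin N) → ℂ}
    (hg : ∀ y, ‖g y‖ ≤ 1) (s : Database M N → ℂ) :
    ∑ D, ‖recordPhase x g s D‖ ^ 2 ≤ ∑ D, ‖s D‖ ^ 2 := by
  have hv := sum_bottomSubUniform_sq hN
  rw [recordPhase, sum_norm_sq_reflectAt hv, ← sum_norm_sq_reflectAt hv x s]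
  gcongr with D
  rw [Pi.mul_apply, norm_mul]
  exact mul_le_of_le_one_left (norm_nonneg _) (hg _)

/-- A query enlarges the database by at most one entry. -/
theorem recordPhase_eq_zero_of_card_domain (x : Fin M) (g : Option (Fin N) → ℂ)
    {s : Database M N → ℂ} {t : ℕ} (hs : ∀ D, t < D.domain.card → s D = 0) (D : Database M N)
    (hD : t + 1 < D.domain.card) : recordPhase x g s D = 0 := by
  rw [← Function.update_eq_self x D]
  refine recordPhase_update_eq_zero (fun y => hs _ ?_) _
  have h1 := D.card_domain_update_le x (D x)
  have h2 := D.card_domain_update_none_le x y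
  rw [Function.update_eq_self] at h1
  omega

/-- A query is unlikely to increase the excess of a database with few entries. -/
theorem sum_norm_sq_recordPhase_excess_le (hN : 0 < N) (x : Fin M) {g : Option (Fin N) → ℂ}
    (hg : ∀ y, ‖g y‖ ≤ 1) {s : Database M N → ℂ} {t : ℕ}
    (hs : ∀ D, t < D.domain.card → s D = 0) (k : ℕ) :
    ∑ D : Database M N, (if k + 1 ≤ D.excess then
        ‖recordPhase x g (fun D => if k + 1 ≤ D.excess then 0 else s D) D‖ ^ 2 else 0)
      ≤ 8 * t / N * ∑ D : Database M N, (if k ≤ D.excess then ‖s D‖ ^ 2 else 0) := by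
  have hv := sum_bottomSubUniform_sq hN
  rw [Finset.mul_sum]
  refine sum_le_sum_of_update x fun D => ?_
  set r : Database M N → ℂ := fun D => if k + 1 ≤ D.excess then 0 else s D with hr
  rw [← Finset.mul_sum]
  have hnn : 0 ≤ 8 * t / N * ∑ y, (if k ≤ Database.excess (Function.update D x y) then
      ‖s (Function.update D x y)‖ ^ 2 else 0) := by
    refine mul_nonneg (by positivity) (Finset.sum_nonneg fun y _ => ?_)
    split_ifs <;> positivity
  by_cases hzero : ∀ y, r (Function.update D x y) = 0
  · simpa [recordPhase_update_eq_zero hzero] using hnn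
  rcases lt_or_ge (Database.excess (Function.update D x none)) k with hk | hk
  · have hlt : ∀ y, ¬ k + 1 ≤ Database.excess (Function.update D x y) := by
      intro y
      have := Database.excess_update_le D x y
      omega
    simpa [hlt] using hnn
  -- In the remaining case the excess with `x` unrecorded is exactly `k`, so the whole fiber is
  -- counted on the right-hand side.
  have hge : ∀ y, k ≤ Database.excess (Function.update D x y) := fun y =>
    hk.trans (Database.excess_update_none_le D x y)
  push Not at hzero
  obtain ⟨y₀, hy₀⟩ := hzero
  have hs₀ : s (Function.update D x y₀) ≠ 0 := by
    intro h
    simp [hr, h] at hy₀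
  have hex₀ : ¬ k + 1 ≤ Database.excess (Function.update D x y₀) := by
    intro h
    simp only [hr, h, if_true] at hy₀
    exact hy₀ rfl
  have hnone : ¬ k + 1 ≤ Database.excess (Function.update D x none) := by
    have := Database.excess_update_none_le D x y₀
    omega
  have hcard : (Database.domain (Function.update D x none)).card ≤ t := by
    by_contra h
    have := Database.card_domain_update_none_le D x y₀
    exact hs₀ (hs _ (by omega))
  set Y := Finset.univ.filter fun y => k + 1 ≤ Database.excess (Function.update D x y) with hY
  -- The values that raise the excess are those already recorded, at most `t` in number.
  have hYr : Y ⊆ Database.range (Function.update D x none) := by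
    intro y hy
    have hy' := (Finset.mem_filter.1 hy).2
    cases y with
    | none => exact absurd hy' hnone
    | some y =>
      rw [Database.excess_update_some] at hy'
      by_contra h
      rw [if_neg h] at hy'
      omega
  have hYt : (Y.card : ℝ) ≤ t := by
    have := (Finset.card_le_card hYr).trans ((Database.range_card_le _).trans hcard)
    exact_mod_cast this
  rw [← Finset.sum_filter]
  simp only [recordPhase_update]
  calc _ ≤ Y.card * (8 * (1 / N) * ∑ y, ‖r (Function.update D x y)‖ ^ 2) := by
        refine sum_norm_sq_reflect_conj_le hv hg ?_ ?_
        · intro y hy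
          cases y with
          | none => exact absurd (Finset.mem_filter.1 hy).2 hnone
          | some y => exact (bottomSubUniform_some_sq y).le
        · intro y hy
          simp only [hr, (Finset.mem_filter.1 hy).2, if_true]
    _ ≤ t * (8 * (1 / N) * ∑ y, ‖s (Function.update D x y)‖ ^ 2) := by
        gcongr with y
        simp only [hr]
        split_ifs <;> simp
    _ = _ := by
        simp only [hge, if_true]
        ring

variable {W Z : Type} [Fintype W]

/-- The norm of the component of a joint state of memory and database on the databases of excess
at least `k`. -/
def excessNorm (φ : BasisLabel M N W → Database M N → ℂ) (k : ℕ) : ℝ :=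
  √(∑ b, ∑ D : Database M N, if k ≤ D.excess then ‖φ b D‖ ^ 2 else 0)

theorem excessNorm_nonneg (φ : BasisLabel M N W → Database M N → ℂ) (k : ℕ) :
    0 ≤ excessNorm φ k := Real.sqrt_nonneg _

theorem excessNorm_sq (φ : BasisLabel M N W → Database M N → ℂ) (k : ℕ) :
    excessNorm φ k ^ 2
      = ∑ b, ∑ D : Database M N, if k ≤ D.excess then ‖φ b D‖ ^ 2 else 0 :=
  Real.sq_sqrt (Finset.sum_nonneg fun _ _ => Finset.sum_nonneg fun _ _ => by positivity)

theorem excessNorm_zero_sq (φ : BasisLabel M N W → Database M N → ℂ) :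
    excessNorm φ 0 ^ 2 = ∑ b, ∑ D, ‖φ b D‖ ^ 2 := by
  simp [excessNorm_sq]

/-- The phase `ω_N ^ (p y)`, or `1` if no value is recorded. -/
def recordedPhase (p : Fin N) : Option (Fin N) → ℂ
  | none => 1
  | some y => omega N ^ ((p : ℕ) * (y : ℕ))

theorem norm_omega (N : ℕ) : ‖omega N‖ = 1 := by
  have : 2 * Real.pi * Complex.I / N = ((2 * Real.pi / N : ℝ) : ℂ) * Complex.I := by
    push_cast
    ring
  rw [omega, this, Complex.norm_exp_ofReal_mul_I]

theorem norm_recordedPhase (p : Fin N) (y : Option (Fin N)) : ‖recordedPhase p y‖ = 1 := by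
  cases y <;> simp [recordedPhase, norm_omega]

/-- The recording query operator. -/
def recordQuery (φ : BasisLabel M N W → Database M N → ℂ) : BasisLabel M N W → Database M N → ℂ :=
  fun b => recordPhase b.1 (recordedPhase b.2.1) (φ b)

theorem excessNorm_recordQuery_zero_le (hN : 0 < N) (φ : BasisLabel M N W → Database M N → ℂ) :
    excessNorm (recordQuery φ) 0 ≤ excessNorm φ 0 := by
  refine (sq_le_sq₀ (excessNorm_nonneg _ _) (excessNorm_nonneg _ _)).1 ?_
  rw [excessNorm_zero_sq, excessNorm_zero_sq]
  exact Finset.sum_le_sum fun b _ =>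
    sum_norm_sq_recordPhase_le hN _ (fun y => (norm_recordedPhase _ y).le) _

/-- The part already at level `k + 1` cannot grow, as a query is a contraction; the part below
enters that level only with the factor `√(8t/N)`. The triangle inequality combines them. -/
theorem excessNorm_recordQuery_succ_le (hN : 0 < N) {φ : BasisLabel M N W → Database M N → ℂ}
    {t : ℕ} (hφ : ∀ b D, t < D.domain.card → φ b D = 0) (k : ℕ) :
    excessNorm (recordQuery φ) (k + 1)
      ≤ excessNorm φ (k + 1) + √(8 * t / N) * excessNorm φ k := by
  have hg : ∀ (p : Fin N) y, ‖recordedPhase p y‖ ≤ 1 := fun p y => (norm_recordedPhase p y).le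
  let hi : BasisLabel M N W → Database M N → ℂ := fun b D => if k + 1 ≤ D.excess then φ b D else 0
  let lo : BasisLabel M N W → Database M N → ℂ := fun b D => if k + 1 ≤ D.excess then 0 else φ b D
  have hsplit : φ = fun b => hi b + lo b := by
    ext b D
    simp only [hi, lo, Pi.add_apply]
    split_ifs <;> simp
  let u : BasisLabel M N W × Database M N → ℂ := fun q =>
    if k + 1 ≤ q.2.excess then recordQuery hi q.1 q.2 else 0
  let w : BasisLabel M N W × Database M N → ℂ := fun q =>
    if k + 1 ≤ q.2.excess then recordQuery lo q.1 q.2 else 0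
  have h1 : excessNorm (recordQuery φ) (k + 1) = √(∑ q, ‖u q + w q‖ ^ 2) := by
    rw [excessNorm]
    conv_rhs => rw [Fintype.sum_prod_type]
    congr 1
    refine Finset.sum_congr rfl fun b _ => Finset.sum_congr rfl fun D _ => ?_
    have : recordQuery φ b = recordQuery hi b + recordQuery lo b := by
      conv_lhs => rw [hsplit]
      exact recordPhase_add b.1 (recordedPhase b.2.1) (hi b) (lo b)
    simp only [u, w, this]
    split_ifs <;> simp
  have h2 : √(∑ q, ‖u q‖ ^ 2) ≤ excessNorm φ (k + 1) := by
    refine Real.sqrt_le_sqrt ?_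
    rw [Fintype.sum_prod_type]
    refine Finset.sum_le_sum fun b _ => ?_
    calc ∑ D, ‖u (b, D)‖ ^ 2 ≤ ∑ D, ‖recordQuery hi b D‖ ^ 2 := by
          gcongr with D
          simp only [u]
          split_ifs <;> simp
      _ ≤ ∑ D, ‖hi b D‖ ^ 2 := sum_norm_sq_recordPhase_le hN _ (hg _) _
      _ = _ := by
          refine Finset.sum_congr rfl fun D _ => ?_
          simp only [hi]
          split_ifs <;> simp
  have h3 : √(∑ q, ‖w q‖ ^ 2) ≤ √(8 * t / N) * excessNorm φ k := by
    rw [excessNorm, ← Real.sqrt_mul (by positivity)]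
    refine Real.sqrt_le_sqrt ?_
    rw [Fintype.sum_prod_type, Finset.mul_sum]
    refine Finset.sum_le_sum fun b _ => ?_
    refine le_trans (le_of_eq ?_)
      (sum_norm_sq_recordPhase_excess_le hN b.1 (hg b.2.1) (hφ b) k)
    refine Finset.sum_congr rfl fun D _ => ?_
    simp only [w, recordQuery, lo]
    split_ifs <;> simp
  rw [h1]
  exact (sqrt_sum_norm_add_sq_le u w).trans (add_le_add h2 h3)

/-- The action of an operator on the memory on a joint state of memory and database. -/
def applyMemory (U : Memory M N W ≃ₗᵢ[ℂ] Memory M N W)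
    (φ : BasisLabel M N W → Database M N → ℂ) : BasisLabel M N W → Database M N → ℂ :=
  fun b D => U (WithLp.toLp 2 fun b' => φ b' D) b

theorem sum_norm_sq_applyMemory (U : Memory M N W ≃ₗᵢ[ℂ] Memory M N W)
    (φ : BasisLabel M N W → Database M N → ℂ) (D : Database M N) :
    ∑ b, ‖applyMemory U φ b D‖ ^ 2 = ∑ b, ‖φ b D‖ ^ 2 := by
  have h := U.norm_map (WithLp.toLp 2 fun b' => φ b' D)
  have h2 := congrArg (· ^ 2) h
  simpa only [EuclideanSpace.norm_sq_eq, applyMemory] using h2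

theorem excessNorm_applyMemory (U : Memory M N W ≃ₗᵢ[ℂ] Memory M N W)
    (φ : BasisLabel M N W → Database M N → ℂ) (k : ℕ) :
    excessNorm (applyMemory U φ) k = excessNorm φ k := by
  rw [excessNorm, excessNorm, Finset.sum_comm]
  conv_rhs => rw [Finset.sum_comm]
  congr 1
  refine Finset.sum_congr rfl fun D _ => ?_
  split_ifs
  · exact sum_norm_sq_applyMemory U φ D
  · simp

variable [DecidableEq W]

/-- The coefficients do not depend on the database, so linear operators on the database commute with
operators on the memory. -/
theorem applyMemory_eq_sum (U : Memory M N W ≃ₗᵢ[ℂ] Memory M N W)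
    (φ : BasisLabel M N W → Database M N → ℂ) (b : BasisLabel M N W) :
    applyMemory U φ b = ∑ b', U (EuclideanSpace.single b' 1) b • φ b' := by
  ext D
  have h : (WithLp.toLp 2 fun b' => φ b' D : Memory M N W)
      = ∑ b', φ b' D • EuclideanSpace.single b' (1 : ℂ) := by
    ext b
    simp [Finset.sum_apply, Pi.single_apply]
  rw [applyMemory, h, map_sum]
  simp [mul_comm]

theorem applyMemory_eq_zero (U : Memory M N W ≃ₗᵢ[ℂ] Memory M N W)
    {φ : BasisLabel M N W → Database M N → ℂ} {D : Database M N} (h : ∀ b, φ b D = 0)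
    (b : BasisLabel M N W) : applyMemory U φ b D = 0 := by
  rw [applyMemory_eq_sum]
  simp [h]

theorem reflectOn_applyMemory (J : Finset (Fin M)) (U : Memory M N W ≃ₗᵢ[ℂ] Memory M N W)
    (φ : BasisLabel M N W → Database M N → ℂ) (b : BasisLabel M N W) :
    reflectOn (bottomSubUniform N) J (applyMemory U φ b)
      = applyMemory U (fun b => reflectOn (bottomSubUniform N) J (φ b)) b := by
  rw [applyMemory_eq_sum, applyMemory_eq_sum, map_sum]
  simp only [map_smul]

namespace QueryAlgorithm

/-- The initial basis state of the memory, together with the empty database. -/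
def recordedStart (A : QueryAlgorithm M N T W Z) : BasisLabel M N W → Database M N → ℂ :=
  fun b D => if b = A.start then ∏ x, (if D x = none then 1 else 0) else 0

/-- The joint state of the memory and the database after `t` recording queries. -/
def recordedState (A : QueryAlgorithm M N T W Z) (t : Fin (T + 1)) :
    BasisLabel M N W → Database M N → ℂ :=
  Fin.induction (motive := fun _ => BasisLabel M N W → Database M N → ℂ)
    (applyMemory (A.U 0) A.recordedStart)
    (fun s φ => applyMemory (A.U s.succ) (recordQuery φ)) t

theorem recordedState_zero (A : QueryAlgorithm M N T W Z) :
    A.recordedState 0 = applyMemory (A.U 0) A.recordedStart := rfl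

theorem recordedState_succ (A : QueryAlgorithm M N T W Z) (t : Fin T) :
    A.recordedState t.succ = applyMemory (A.U t.succ) (recordQuery (A.recordedState t.castSucc)) :=
  Fin.induction_succ _ _ _

theorem state_succ (A : QueryAlgorithm M N T W Z) (f : Fin M → Fin N) (t : Fin T) :
    A.state f t.succ = A.U t.succ (oracle f (A.state f t.castSucc)) :=
  Fin.induction_succ _ _ _

theorem recordedStart_eq_zero (A : QueryAlgorithm M N T W Z) {D : Database M N}
    (hD : 0 < D.domain.card) (b : BasisLabel M N W) : A.recordedStart b D = 0 := by
  obtain ⟨x, hx⟩ := Finset.card_pos.1 hD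
  rw [recordedStart, Finset.prod_eq_zero (Finset.mem_univ x) (if_neg (Database.mem_domain.1 hx)),
    ite_self]

theorem recordedState_eq_zero (A : QueryAlgorithm M N T W Z) (t : Fin (T + 1)) :
    ∀ (b : BasisLabel M N W) (D : Database M N), (t : ℕ) < D.domain.card →
      A.recordedState t b D = 0 := by
  induction t using Fin.induction with
  | zero =>
    intro b D hD
    exact applyMemory_eq_zero _ (A.recordedStart_eq_zero hD) b
  | succ t ih =>
    intro b D hD
    rw [recordedState_succ]
    refine applyMemory_eq_zero _ (fun b => ?_) b
    exact recordPhase_eq_zero_of_card_domain _ _ (ih b) D (by simpa using hD)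

theorem excessNorm_recordedStart_zero (A : QueryAlgorithm M N T W Z) :
    excessNorm A.recordedStart 0 = 1 := by
  rw [← sq_eq_sq₀ (excessNorm_nonneg _ _) zero_le_one, excessNorm_zero_sq,
    Finset.sum_eq_single A.start, Finset.sum_eq_single fun _ => none]
  · simp [recordedStart]
  · intro D _ hD
    obtain ⟨x, hx⟩ := Function.ne_iff.1 hD
    rw [A.recordedStart_eq_zero (Finset.card_pos.2 ⟨x, Database.mem_domain.2 hx⟩)]
    simp
  · simp
  · intro b _ hb
    simp [recordedStart, hb]
  · simp

theorem excessNorm_recordedState_zero_le (hN : 0 < N) (A : QueryAlgorithm M N T W Z)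
    (t : Fin (T + 1)) : excessNorm (A.recordedState t) 0 ≤ 1 := by
  induction t using Fin.induction with
  | zero =>
    rw [recordedState_zero, excessNorm_applyMemory, excessNorm_recordedStart_zero]
  | succ t ih =>
    rw [recordedState_succ, excessNorm_applyMemory]
    exact (excessNorm_recordQuery_zero_le hN _).trans ih

/-- The one-query recursion is Pascal's rule once `t` is replaced by `T` under the root. -/
theorem excessNorm_recordedState_le (hN : 0 < N) (A : QueryAlgorithm M N T W Z)
    (t : Fin (T + 1)) :
    ∀ k, excessNorm (A.recordedState t) k ≤ (t : ℕ).choose k * √(8 * T / N) ^ k := by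
  induction t using Fin.induction with
  | zero =>
    intro k
    cases k with
    | zero => simpa using A.excessNorm_recordedState_zero_le hN 0
    | succ k =>
      rw [recordedState_zero, excessNorm_applyMemory, excessNorm, Finset.sum_eq_zero]
      · simp
      · intro b _
        refine Finset.sum_eq_zero fun D _ => ?_
        split_ifs with h
        · rw [A.recordedStart_eq_zero]
          · simp
          · rw [Database.excess] at h
            omega
        · rfl
  | succ t ih =>
    intro k
    cases k with
    | zero => simpa using A.excessNorm_recordedState_zero_le hN t.succ
    | succ k =>
      rw [recordedState_succ, excessNorm_applyMemory]
      have ht : ((t : ℕ) : ℝ) ≤ T := by exact_mod_cast t.2.le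
      have h0 := excessNorm_recordQuery_succ_le hN (A.recordedState_eq_zero t.castSucc) k
      have h1 := ih (k + 1)
      have h2 := ih k
      simp only [Fin.val_castSucc] at h0 h1 h2
      calc _ ≤ _ := h0
        _ ≤ (t : ℕ).choose (k + 1) * √(8 * T / N) ^ (k + 1)
            + √(8 * T / N) * ((t : ℕ).choose k * √(8 * T / N) ^ k) := by
          have := excessNorm_nonneg (A.recordedState t.castSucc) k
          gcongr
        _ = _ := by
          rw [Fin.val_succ, Nat.choose_succ_succ]
          push_cast
          ring

end QueryAlgorithm

theorem reflectAt_prod {ι α : Type*} [Fintype ι] [DecidableEq ι] [Fintype α] (v : α → ℝ)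
    (h : ι → α → ℂ) (j : ι) :
    reflectAt v j (fun D => ∏ i, h i (D i))
      = fun D => ∏ i, Function.update h j (reflect v (h j)) i (D i) := by
  ext D
  have hP : ∀ (h' : ι → α → ℂ) (D' : ι → α), ∏ i, h' i (D' i)
      = h' j (D' j) * ∏ i ∈ Finset.univ.erase j, h' i (D' i) := fun h' D' =>
    (Finset.mul_prod_erase _ _ (Finset.mem_univ j)).symm
  have h1 : ∀ y, ∏ i ∈ Finset.univ.erase j, h i (Function.update D j y i)
      = ∏ i ∈ Finset.univ.erase j, h i (D i) := fun y =>
    Finset.prod_congr rfl fun i hi => by rw [Function.update_of_ne (Finset.ne_of_mem_erase hi)]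
  have h2 : ∏ i ∈ Finset.univ.erase j, Function.update h j (reflect v (h j)) i (D i)
      = ∏ i ∈ Finset.univ.erase j, h i (D i) :=
    Finset.prod_congr rfl fun i hi => by rw [Function.update_of_ne (Finset.ne_of_mem_erase hi)]
  rw [reflectAt_apply, hP _ D, hP _ D, h2]
  simp only [hP _ (Function.update _ _ _), h1, Function.update_self, reflect, ← mul_assoc,
    ← Finset.sum_mul]
  ring

theorem reflectOn_prod {ι α : Type*} [Fintype ι] [DecidableEq ι] [Fintype α] (v : α → ℝ)
    (h : α → ℂ) (J : Finset ι) :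
    reflectOn v J (fun D => ∏ i, h (D i))
      = fun D => ∏ i, (if i ∈ J then reflect v h else h) (D i) := by
  induction J using Finset.induction_on with
  | empty => simp [reflectOn_empty]
  | insert j J hj ih =>
    rw [reflectOn_insert v hj, ih, reflectAt_prod]
    ext D
    refine Finset.prod_congr rfl fun i _ => ?_
    rcases eq_or_ne i j with rfl | hij
    · simp [hj]
    · simp [hij]

/-- This is the reason for the choice of `v`: subtracting it from `⊥` leaves the uniform
superposition. -/
theorem reflect_bottom_some (y : Fin N) :
    reflect (bottomSubUniform N) (fun z => if z = none then 1 else 0) (some y)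
      = ((1 / √N : ℝ) : ℂ) := by
  simp [reflect, bottomSubUniform]

namespace QueryAlgorithm

/-- Reflecting all the registers of the database turns the recorded state into the superposition
of the states of the algorithm over all inputs. -/
theorem reflectOn_recordedState (hN : 0 < N) (A : QueryAlgorithm M N T W Z) (f : Fin M → Fin N)
    (t : Fin (T + 1)) : ∀ b, reflectOn (bottomSubUniform N) Finset.univ (A.recordedState t b)
      (fun x => some (f x)) = ((1 / √N : ℝ) : ℂ) ^ M * A.state f t b := by
  have key : ∀ (U : Memory M N W ≃ₗᵢ[ℂ] Memory M N W) (φ : BasisLabel M N W → Database M N → ℂ)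
      (ψ : Memory M N W), (∀ b, reflectOn (bottomSubUniform N) Finset.univ (φ b)
        (fun x => some (f x)) = ((1 / √N : ℝ) : ℂ) ^ M * ψ b) →
      ∀ b, reflectOn (bottomSubUniform N) Finset.univ (applyMemory U φ b)
        (fun x => some (f x)) = ((1 / √N : ℝ) : ℂ) ^ M * U ψ b := by
    intro U φ ψ h b
    rw [reflectOn_applyMemory]
    simp only [applyMemory, h]
    have : (WithLp.toLp 2 fun b' => ((1 / √N : ℝ) : ℂ) ^ M * ψ b' : Memory M N W)
        = ((1 / √N : ℝ) : ℂ) ^ M • ψ := by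
      ext b
      simp
    rw [this, map_smul]
    simp
  induction t using Fin.induction with
  | zero =>
    refine key _ _ _ fun b => ?_
    by_cases hb : b = A.start
    · subst hb
      have h : A.recordedStart A.start = fun D => ∏ x, (if D x = none then 1 else 0) := by
        ext D
        simp [recordedStart]
      rw [h, reflectOn_prod (bottomSubUniform N) (fun z => if z = none then 1 else 0)]
      simp only [Finset.mem_univ, if_true, reflect_bottom_some]
      simp
    · have h : A.recordedStart b = 0 := by
        ext D
        simp [recordedStart, hb]
      simp [h, hb]
  | succ t ih =>
    rw [recordedState_succ, state_succ]
    refine key _ _ _ fun b => ?_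
    have := reflectOn_conj (sum_bottomSubUniform_sq hN) b.1 (recordedPhase b.2.1)
      (A.recordedState t.castSucc b)
    rw [recordQuery, recordPhase, this, Pi.mul_apply, ih b]
    simp only [recordedPhase, oracle, LinearMap.coe_mk, AddHom.coe_mk]
    ring

end QueryAlgorithm

end Recording

/-! ### From recorded excess to success probability. -/

section SuccessProbability

variable {M N K T : ℕ}

theorem areDisjointCollisions_iff {f : Fin M → Fin N} {z : Fin K → Fin M × Fin M} :
    AreDisjointCollisions f z ↔ PairsDistinct z ∧ ∀ i, f (z i).1 = f (z i).2 :=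
  ⟨fun h => ⟨⟨fun i => (h.1 i).1, h.2⟩, fun i => (h.1 i).2⟩,
    fun h => ⟨fun i => ⟨h.1.1 i, h.2 i⟩, h.1.2⟩⟩

theorem norm_basisProj_sq {W : Type} [Fintype W] (S : Set (BasisLabel M N W))
    [DecidablePred (· ∈ S)] (ψ : Memory M N W) :
    ‖basisProj S ψ‖ ^ 2 = ∑ b, if b ∈ S then ‖ψ b‖ ^ 2 else 0 := by
  rw [EuclideanSpace.norm_sq_eq]
  refine Finset.sum_congr rfl fun b _ => ?_
  by_cases h : b ∈ S <;> simp [basisProj, h]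

/-- The number of functions that take equal values on `K` disjoint pairs is at most
`N ^ (M - K)`. -/
theorem card_filter_eq_mul_pow_le {z : Fin K → Fin M × Fin M} (hz : PairsDistinct z) :
    (Finset.univ.filter fun f : Fin M → Fin N => ∀ i, f (z i).1 = f (z i).2).card * N ^ K
      ≤ N ^ M := by
  set B := Finset.univ.image fun i => (z i).2 with hB
  have hinj : Function.Injective fun i => (z i).2 := by
    intro i j hij
    by_contra hne
    exact (hz.2 i j hne).2.2.2 hij
  have hcard : B.card = K := by
    rw [hB, Finset.card_image_of_injective _ hinj, Finset.card_univ, Fintype.card_fin]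
  have hfst : ∀ i, (z i).1 ∉ B := by
    intro i h
    obtain ⟨j, -, hj⟩ := Finset.mem_image.1 h
    rcases eq_or_ne i j with rfl | hij
    · exact hz.1 i hj.symm
    · exact (hz.2 i j hij).2.1 hj.symm
  -- Such a function is determined by its values off the second entries.
  have hle : (Finset.univ.filter fun f : Fin M → Fin N => ∀ i, f (z i).1 = f (z i).2).card
      ≤ (Finset.univ : Finset ({x // x ∉ B} → Fin N)).card := by
    refine Finset.card_le_card_of_injOn (fun f x => f x.1) (fun _ _ => Finset.mem_coe.2
      (Finset.mem_univ _)) ?_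
    intro f hf g hg hfg
    have hf' := (Finset.mem_filter.1 (Finset.mem_coe.1 hf)).2
    have hg' := (Finset.mem_filter.1 (Finset.mem_coe.1 hg)).2
    have hoff : ∀ x, x ∉ B → f x = g x := fun x hx => congrFun hfg ⟨x, hx⟩
    ext1 x
    by_cases hx : x ∈ B
    · obtain ⟨i, -, rfl⟩ := Finset.mem_image.1 hx
      exact (hf' i).symm.trans ((hoff _ (hfst i)).trans (hg' i))
    · exact hoff x hx
  have hsub : Fintype.card {x // x ∉ B} = M - K := by
    rw [Fintype.card_subtype_compl, Fintype.card_fin, Fintype.card_coe, hcard]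
  have hKM : K ≤ M := by
    rw [← hcard]
    exact B.card_le_univ.trans_eq (Fintype.card_fin M)
  rw [Finset.card_univ, Fintype.card_fun, hsub, Fintype.card_fin] at hle
  calc _ ≤ N ^ (M - K) * N ^ K := Nat.mul_le_mul_right _ hle
    _ = N ^ M := by rw [← pow_add, Nat.sub_add_cancel hKM]

variable {W : Type} [Fintype W] [DecidableEq W]

namespace QueryAlgorithm

/-- An algorithm that makes no query outputs `K` disjoint collisions with probability at most
`N ^ (-K)`. -/
theorem successProb_le_of_no_query (hN : 0 < N)
    (A : QueryAlgorithm M N 0 W (Fin K → Fin M × Fin M)) :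
    A.successProb AreDisjointCollisions ≤ (1 / N) ^ K := by
  classical
  set ψ := A.U 0 (EuclideanSpace.single A.start 1) with hψ
  have hψ1 : ∑ b, ‖ψ b‖ ^ 2 = 1 := by
    rw [← EuclideanSpace.norm_sq_eq, hψ, LinearIsometryEquiv.norm_map]
    simp
  have hN' : (0 : ℝ) < N := by exact_mod_cast hN
  -- Without queries the output distribution is independent of `f`, so each fixed output can be
  -- treated separately.
  have hcount : ∀ z : Fin K → Fin M × Fin M,
      (∑ f : Fin M → Fin N, if AreDisjointCollisions f z then (1 : ℝ) else 0)
        ≤ (N : ℝ) ^ M * (1 / N) ^ K := by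
    intro z
    by_cases hz : PairsDistinct z
    · simp only [areDisjointCollisions_iff, hz, true_and, Finset.sum_boole]
      rw [one_div, inv_pow, ← div_eq_mul_inv, le_div_iff₀ (by positivity)]
      exact_mod_cast card_filter_eq_mul_pow_le (N := N) hz
    · simp only [areDisjointCollisions_iff, hz, false_and, if_false, Finset.sum_const_zero]
      positivity
  rw [successProb, div_le_iff₀ (by positivity)]
  calc ∑ f, A.successProbOn AreDisjointCollisions f
      = ∑ b, ‖ψ b‖ ^ 2 * ∑ f : Fin M → Fin N,
          (if AreDisjointCollisions f (A.output b.2.2) then (1 : ℝ) else 0) := by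
        simp only [successProbOn, norm_basisProj_sq, Finset.mul_sum]
        rw [Finset.sum_comm]
        refine Finset.sum_congr rfl fun b _ => Finset.sum_congr rfl fun f _ => ?_
        rw [mul_ite, mul_one, mul_zero]
        rfl
    _ ≤ ∑ b, ‖ψ b‖ ^ 2 * ((N : ℝ) ^ M * (1 / N) ^ K) := by
        gcongr with b
        exact hcount _
    _ = (1 / N) ^ K * N ^ M := by rw [← Finset.sum_mul, hψ1, one_mul, mul_comm]

-- The amplitude `N^(-M/2)` on total databases squares to the weight of the uniform average over
-- `f`; databases with an unrecorded input only add nonnegative terms.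
open Classical in
theorem successProb_le_sum_reflectOn (hN : 0 < N)
    (A : QueryAlgorithm M N T W (Fin K → Fin M × Fin M)) :
    A.successProb AreDisjointCollisions ≤ ∑ b, ∑ D : Database M N,
      if PairsDistinct (A.output b.2.2)
          ∧ ∀ i, Collide (D (A.output b.2.2 i).1) (D (A.output b.2.2 i).2) then
        ‖reflectOn (bottomSubUniform N) Finset.univ (A.recordedState (Fin.last T) b) D‖ ^ 2
      else 0 := by
  have hN' : (0 : ℝ) < N := by exact_mod_cast hN
  simp only [successProb, successProbOn, norm_basisProj_sq]
  rw [Finset.sum_comm, Finset.sum_div]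
  refine Finset.sum_le_sum fun b _ => ?_
  set z := A.output b.2.2 with hz
  set F : Database M N → ℝ := fun D =>
    if PairsDistinct z ∧ ∀ i, Collide (D (z i).1) (D (z i).2) then
      ‖reflectOn (bottomSubUniform N) Finset.univ (A.recordedState (Fin.last T) b) D‖ ^ 2
    else 0 with hF
  have hinj : Function.Injective fun (f : Fin M → Fin N) (x : Fin M) => some (f x) := by
    intro f g h
    ext1 x
    exact Option.some_injective _ (congrFun h x)
  calc _ = ∑ f : Fin M → Fin N, F fun x => some (f x) := by
        rw [Finset.sum_div]
        refine Finset.sum_congr rfl fun f _ => ?_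
        have hiff : (PairsDistinct z ∧ ∀ i, Collide (some (f (z i).1)) (some (f (z i).2)))
            ↔ AreDisjointCollisions f z := by
          rw [areDisjointCollisions_iff]
          simp [Collide, eq_comm]
        simp only [hF, hiff, A.reflectOn_recordedState hN, Set.mem_ofPred_eq, ← hz]
        split_ifs
        · rw [norm_mul, mul_pow, norm_pow, Complex.norm_real, Real.norm_eq_abs, ← pow_mul,
            mul_comm M 2, pow_mul, sq_abs, div_pow, Real.sq_sqrt hN'.le, div_pow]
          simp
          ring
        · simp
    _ = ∑ D ∈ Finset.univ.map ⟨_, hinj⟩, F D := by simp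
    _ ≤ ∑ D, F D := by
        refine Finset.sum_le_sum_of_subset_of_nonneg (Finset.subset_univ _) fun D _ _ => ?_
        simp only [hF]
        positivity

theorem successProb_le_one (hN : 0 < N) (A : QueryAlgorithm M N T W (Fin K → Fin M × Fin M)) :
    A.successProb AreDisjointCollisions ≤ 1 := by
  classical
  refine (A.successProb_le_sum_reflectOn hN).trans ?_
  calc _ ≤ ∑ b, ∑ D, ‖reflectOn (bottomSubUniform N) Finset.univ
        (A.recordedState (Fin.last T) b) D‖ ^ 2 := by
        gcongr with b _ D
        split_ifs <;> simp
    _ = excessNorm (A.recordedState (Fin.last T)) 0 ^ 2 := by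
        rw [excessNorm_zero_sq]
        simp only [sum_norm_sq_reflectOn (sum_bottomSubUniform_sq hN)]
    _ ≤ 1 := pow_le_one₀ (excessNorm_nonneg _ _) (A.excessNorm_recordedState_zero_le hN _)

/-- An algorithm succeeds only if the database records about `K / 2` collisions, up to a small
probability of guessing. -/
theorem successProb_le_excessNorm (hN : 1536 ≤ N)
    (A : QueryAlgorithm M N T W (Fin K → Fin M × Fin M)) :
    A.successProb AreDisjointCollisions
      ≤ 2 * excessNorm (A.recordedState (Fin.last T)) ((K + 1) / 2) ^ 2 + 2 * (1 / 4) ^ K := by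
  classical
  have hN0 : 0 < N := by omega
  have hv := sum_bottomSubUniform_sq hN0
  set v := bottomSubUniform N
  set φ := A.recordedState (Fin.last T) with hφ
  set k := (K + 1) / 2 with hk
  have key : ∀ b, ∑ D : Database M N, (if PairsDistinct (A.output b.2.2)
          ∧ ∀ i, Collide (D (A.output b.2.2 i).1) (D (A.output b.2.2 i).2) then
        ‖reflectOn v Finset.univ (φ b) D‖ ^ 2 else 0)
      ≤ 2 * (∑ D : Database M N, if k ≤ D.excess then ‖φ b D‖ ^ 2 else 0)
        + 2 * ((1 / 4) ^ K * ∑ D, ‖φ b D‖ ^ 2) := by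
    intro b
    set z := A.output b.2.2
    by_cases hz : PairsDistinct z
    swap
    · simp only [hz, false_and, if_false, Finset.sum_const_zero]
      have : 0 ≤ ∑ D : Database M N, if k ≤ D.excess then ‖φ b D‖ ^ 2 else 0 :=
        Finset.sum_nonneg fun D _ => by positivity
      positivity
    let hi : Database M N → ℂ := fun D => if k ≤ D.excess then φ b D else 0
    let lo : Database M N → ℂ := fun D => if k ≤ D.excess then 0 else φ b D
    have hsplit : φ b = hi + lo := by
      ext D
      simp only [hi, lo, Pi.add_apply]
      split_ifs <;> simp
    have hhi : ∑ D, ‖hi D‖ ^ 2 = ∑ D : Database M N, if k ≤ D.excess then ‖φ b D‖ ^ 2 else 0 := by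
      refine Finset.sum_congr rfl fun D _ => ?_
      simp only [hi]
      split_ifs <;> simp
    have hlo : ∑ D, ‖lo D‖ ^ 2 ≤ ∑ D, ‖φ b D‖ ^ 2 := by
      gcongr with D
      simp only [lo]
      split_ifs <;> simp
    have hguess := sum_norm_sq_reflectOn_collide_le hN hz lo fun D hD => if_pos hD
    calc _ ≤ ∑ D : Database M N, (2 * ‖reflectOn v Finset.univ hi D‖ ^ 2
          + 2 * if ∀ i, Collide (D (z i).1) (D (z i).2) then
            ‖reflectOn v Finset.univ lo D‖ ^ 2 else 0) := by
          refine Finset.sum_le_sum fun D _ => ?_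
          simp only [hz, true_and]
          split_ifs
          · rw [hsplit, map_add]
            exact norm_add_sq_le_two_mul _ _
          · positivity
      _ ≤ _ := by
          rw [Finset.sum_add_distrib, ← Finset.mul_sum, ← Finset.mul_sum,
            sum_norm_sq_reflectOn hv, hhi]
          gcongr
          exact hguess.trans (by gcongr)
  have htot : excessNorm φ 0 ^ 2 ≤ 1 :=
    pow_le_one₀ (excessNorm_nonneg _ _) (A.excessNorm_recordedState_zero_le hN0 _)
  calc _ ≤ _ := A.successProb_le_sum_reflectOn hN0
    _ ≤ _ := Finset.sum_le_sum fun b _ => key b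
    _ = 2 * excessNorm φ k ^ 2 + 2 * ((1 / 4) ^ K * excessNorm φ 0 ^ 2) := by
        rw [excessNorm_sq, excessNorm_zero_sq]
        simp only [Finset.sum_add_distrib, Finset.mul_sum]
    _ ≤ 2 * excessNorm φ k ^ 2 + 2 * ((1 / 4) ^ K * 1) := by gcongr
    _ = _ := by rw [mul_one]

end QueryAlgorithm

/-- This uses `k^k / k! ≤ e^k`, one term of the exponential series, and `e < 3`. -/
theorem choose_le_three_mul_div_pow (n : ℕ) {k : ℕ} (hk : 0 < k) :
    (n.choose k : ℝ) ≤ (3 * n / k) ^ k := by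
  have hk' : (0 : ℝ) < k := by exact_mod_cast hk
  have hf : (0 : ℝ) < k.factorial := by exact_mod_cast k.factorial_pos
  have h1 : (k : ℝ) ^ k / k.factorial ≤ 3 ^ k := by
    refine (Real.pow_div_factorial_le_exp k hk'.le k).trans ?_
    rw [← mul_one (k : ℝ), Real.exp_nat_mul]
    gcongr
    exact Real.exp_one_lt_three.le
  calc (n.choose k : ℝ) ≤ n ^ k / k.factorial := Nat.choose_le_pow_div k n
    _ = (n / k) ^ k * (k ^ k / k.factorial) := by
        rw [div_pow]
        field_simp
    _ ≤ (n / k) ^ k * 3 ^ k := by gcongr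
    _ = (3 * n / k) ^ k := by
        rw [← mul_pow]
        congr 1
        ring

theorem QueryAlgorithm.excessNorm_recordedState_sq_le {W : Type} [Fintype W] [DecidableEq W]
    {Z : Type} (hN : 0 < N) (hK : 1 ≤ K) (A : QueryAlgorithm M N T W Z) :
    excessNorm (A.recordedState (Fin.last T)) ((K + 1) / 2) ^ 2
      ≤ (288 * ((T : ℝ) ^ 3 / ((K : ℝ) ^ 2 * N))) ^ ((K + 1) / 2) := by
  set k := (K + 1) / 2 with hk
  have hk0 : 0 < k := by omega
  have hk0' : (0 : ℝ) < k := by exact_mod_cast hk0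
  have hKk : (K : ℝ) ≤ 2 * k := by
    have : K ≤ 2 * k := by omega
    exact_mod_cast this
  have hK0 : (0 : ℝ) < K := by exact_mod_cast hK
  have hN' : (0 : ℝ) < N := by exact_mod_cast hN
  have h1 := A.excessNorm_recordedState_le hN (Fin.last T) k
  have h2 := choose_le_three_mul_div_pow T hk0
  rw [Fin.val_last] at h1
  calc _ ≤ ((3 * T / k) ^ k * √(8 * T / N) ^ k) ^ 2 := by
        have := excessNorm_nonneg (A.recordedState (Fin.last T)) k
        gcongr
        exact h1.trans (by gcongr)
    -- `72 = 3² * 8`; passing from `k` to `K ≤ 2k` then costs a factor `4`, giving `288`.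
    _ = (72 * (T ^ 3 / (k ^ 2 * N))) ^ k := by
        rw [← mul_pow, ← pow_mul, mul_comm k 2, pow_mul, mul_pow,
          Real.sq_sqrt (by positivity)]
        congr 1
        field_simp
        ring
    _ ≤ _ := by
        refine pow_le_pow_left₀ (by positivity) ?_ k
        have : (T : ℝ) ^ 3 / (k ^ 2 * N) ≤ 4 * (T ^ 3 / (K ^ 2 * N)) := by
          rw [← mul_div_assoc, div_le_div_iff₀ (by positivity) (by positivity)]
          have hsq : (K : ℝ) ^ 2 ≤ 4 * k ^ 2 := by nlinarith
          calc (T : ℝ) ^ 3 * (K ^ 2 * N) ≤ T ^ 3 * (4 * k ^ 2 * N) := by gcongr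
            _ = _ := by ring
        linarith

end SuccessProbability

end

theorem theorem4p4 :
    ∃ C : ℝ, 0 < C ∧
      ∀ (M N K T : ℕ), N ≤ M → 1 ≤ K → 8 * K ≤ N →
        ∀ (W : Type) [Fintype W] [DecidableEq W]
          (A : QueryAlgorithm M N T W (Fin K → Fin M × Fin M)),
          A.successProb AreDisjointCollisions
            ≤ (C * ((T : ℝ) ^ 3 / ((K : ℝ) ^ 2 * (N : ℝ)))) ^ ((K : ℝ) / 2)
              + (2 : ℝ) ^ (-(K : ℝ)) := by
  -- The constant must exceed both `192² * 1536`, for small `N`, and `4 * 288`, for the main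
  -- estimate.
  refine ⟨10 ^ 8, by norm_num, fun M N K T _ hK hKN W _ _ A => ?_⟩
  have hN : 0 < N := by omega
  have hK0 : (0 : ℝ) < K := by exact_mod_cast hK
  have hN0 : (0 : ℝ) < N := by exact_mod_cast hN
  have htwo : (2 : ℝ) ^ (-(K : ℝ)) = (1 / 2) ^ K := by
    rw [Real.rpow_neg (by norm_num), Real.rpow_natCast, one_div, inv_pow]
  rw [htwo]
  -- For `T = 0` the first term gives no help, and guessing at `N^(-K) ≤ 2^(-K)` suffices.
  rcases Nat.eq_zero_or_pos T with rfl | hT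
  · refine (A.successProb_le_of_no_query hN).trans (le_add_of_nonneg_of_le (by positivity) ?_)
    gcongr
    have : 2 ≤ N := by omega
    exact_mod_cast this
  have hT0 : (1 : ℝ) ≤ T := by exact_mod_cast hT
  set X := (T : ℝ) ^ 3 / ((K : ℝ) ^ 2 * N) with hX
  have hX0 : 0 < X := by positivity
  rcases le_or_gt 1 (10 ^ 8 * X) with hCX | hCX
  · calc _ ≤ (1 : ℝ) := A.successProb_le_one hN
      _ ≤ (10 ^ 8 * X) ^ ((K : ℝ) / 2) := Real.one_le_rpow hCX (by positivity)
      _ ≤ _ := le_add_of_nonneg_right (by positivity)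
  -- For `N < 1536` one has `K ≤ 192`, and `T ≥ 1` would force `10^8 * X ≥ 1`, the case already
  -- settled.
  have hNlarge : 1536 ≤ N := by
    by_contra h
    have hN1 : (N : ℝ) ≤ 1536 := by exact_mod_cast (by omega : N ≤ 1536)
    have hK1 : (K : ℝ) ≤ 192 := by exact_mod_cast (by omega : K ≤ 192)
    have hKN2 : (K : ℝ) ^ 2 * N ≤ 192 ^ 2 * 1536 := by gcongr
    have : 1 / (192 ^ 2 * 1536) ≤ X := by
      rw [hX]
      gcongr
      exact one_le_pow₀ hT0
    norm_num at this
    linarith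
  have hpow : 2 * (288 * X) ^ ((K + 1) / 2) ≤ (10 ^ 8 * X) ^ ((K : ℝ) / 2) := by
    calc 2 * (288 * X) ^ ((K + 1) / 2) ≤ 4 ^ ((K : ℝ) / 2) * (288 * X) ^ ((K : ℝ) / 2) := by
          gcongr ?_ * ?_
          · have : (4 : ℝ) ^ ((K : ℝ) / 2) = 2 ^ K := by
              rw [show (4 : ℝ) = 2 ^ (2 : ℝ) by norm_num, ← Real.rpow_mul (by norm_num),
                mul_div_cancel₀ _ (by norm_num), Real.rpow_natCast]
            rw [this]
            exact le_self_pow₀ (by norm_num) (by omega)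
          · rw [← Real.rpow_natCast]
            -- The base is at most `1`, so rounding `K/2` up only decreases the power.
            refine Real.rpow_le_rpow_of_exponent_ge (by positivity) (by linarith) ?_
            rw [div_le_iff₀ (by norm_num)]
            exact_mod_cast (by omega : K ≤ (K + 1) / 2 * 2)
      _ = (4 * (288 * X)) ^ ((K : ℝ) / 2) :=
          (Real.mul_rpow (by norm_num) (by positivity)).symm
      _ ≤ _ := by
          refine Real.rpow_le_rpow (by positivity) ?_ (by positivity)
          linarith
  have hguess : 2 * (1 / 4 : ℝ) ^ K ≤ (1 / 2) ^ K := by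
    calc 2 * (1 / 4 : ℝ) ^ K ≤ 2 ^ K * (1 / 4) ^ K := by
          gcongr
          exact le_self_pow₀ (by norm_num) (by omega)
      _ = (1 / 2) ^ K := by rw [← mul_pow]; norm_num
  have h1 := A.successProb_le_excessNorm hNlarge
  have h2 := A.excessNorm_recordedState_sq_le hN hK
  linarith
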